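/- **Theorem.** For a graph on $[k]=\{1,\dots,k\}$, let its $\pm1$-adjacency matrix have off-diagonal entries $1$ (adjacent) or $-1$ (not adjacent) and zero diagonal. For positive integers $c,d,e$ with $e\le\min\{c,d\}$, let $\mathcal D_{c,d,e}$ be the set of nonnegative real $c\times d$ matrices with all row sums at most $1$, all column sums at most $1$ and all entries summing to $e$, and let $\Pi_{c,d,e}$ be the set of those matrices in $\mathcal D_{c,d,e}$ whose entries all lie in $\{0,1\}$. For each $\mathfrak n=1,2,3,\dots$ let $m,n,K$ be positive integers (functions of $\mathfrak n$) with $\max\{m,n\}=\mathfrak n$ and $K\le\min\{m,n\}$, let $p_{ij}\in[0,1]$ ($1\le i<j\le\mathfrak n$) and $\varrho_{ij}\in[0,1]$ ($1\le i<j\le K$) be real numbers (functions of $\mathfrak n$), and let $(G,H)$ be correlated Bernoulli random graphs with these parameters. That is, $G$ is a random graph on $[m]$ and $H$ a random graph on $[n]$; for $1\le i<j\le m$ the probability of $i\sim_G j$ is $p_{ij}$; for $1\le i<j\le n$ the probability of $i\sim_H j$ is $p_{ij}$; for $1\le i<j\le K$ the Pearson correlation coefficient of the indicators of $i\sim_G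 j$ and $i\sim_H j$ is $\varrho_{ij}$; and, apart from this dependence within each of the pairs of indicators just named, all adjacencies of $G$ and $H$ are collectively independent. The random graphs for all $\mathfrak n$ are defined on one probability space; nothing is assumed about the dependence between different values of $\mathfrak n$. Assume that there is a real number $q\in(0,\tfrac12)$, not depending on $\mathfrak n$, such that for all $\mathfrak n$ we have $p_{ij}\in[q,1-q]$ for all $1\le i<j\le\mathfrak n$ and $\varrho_{ij}>(1-2q)^2$ for all $1\le i<j\le K$. Let $\epsilon=\epsilon(\mathfrak n):=\min_{1\le i<j\le K}\bigl(\varrho_{ij}-(1-2q)^2\bigr)$ (with the convention $\epsilon:=0$ if $K=1$), and assume that $\lim_{\mathfrak n\to\infty}\epsilon^2K/\log\mathfrak n=\infty$. Let $A$ and $B$ be the $\pm1$-adjacency matrices (with zero diagonal) of $G$ and $H$. Then, with probability $1$, for all but finitely many $\mathfrak n$, $$\operatorname*{arg\,max}_{X\in\Pi_{m,n,K}}\operatorname{trace}(AXBX^T)=\operatorname*{arg\,max}_{X\in\mathcal D_{m,n,K}}\operatorname{trace}(AXBX^T)=\left\{\begin{bmatrix}I_K&0\\0&0\end{bmatrix}\right\},$$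 where $I_K$ is the $K\times K$ identity matrix and the zero blocks have the appropriate sizes. -/

import Mathlib

open MeasureTheory ProbabilityTheory

namespace SubgraphMatching

noncomputable section

/-! Vertices `1, …, k` are represented by `Fin k`, that is, by the numbers `0, …, k - 1`. -/

/-- The `±1`-adjacency matrix of a graph, with zero diagonal. -/
def signMatrix {k : ℕ} (G : SimpleGraph (Fin k)) : Matrix (Fin k) (Fin k) ℝ :=
  open Classical in
  Matrix.of fun i j => if i = j then 0 else if G.Adj i j then 1 else -1

/-- The `c × d` matrices with nonnegative real entries, row sums at most `1`, column sums at most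
`1`, and all entries summing to `e`. -/
def relaxedPolytope (c d e : ℕ) : Set (Matrix (Fin c) (Fin d) ℝ) :=
  {X | (∀ i j, 0 ≤ X i j) ∧ (∀ i, ∑ j, X i j ≤ 1) ∧ (∀ j, ∑ i, X i j ≤ 1) ∧
    ∑ i, ∑ j, X i j = (e : ℝ)}

/-- The `c × d` matrices with entries in `{0, 1}`, at most one `1` in each row, at most one `1` in
each column, and exactly `e` entries equal to `1`. -/
def partialPerms (c d e : ℕ) : Set (Matrix (Fin c) (Fin d) ℝ) :=
  {X | (∀ i j, X i j = 0 ∨ X i j = 1) ∧ (∀ i, ∑ j, X i j ≤ 1) ∧ (∀ j, ∑ i, X i j ≤ 1) ∧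
    ∑ i, ∑ j, X i j = (e : ℝ)}

/-- The `c × d` block matrix `[[I_e, 0], [0, 0]]`. -/
def coreMatrix (c d e : ℕ) : Matrix (Fin c) (Fin d) ℝ :=
  Matrix.of fun i j => if (i : ℕ) = (j : ℕ) ∧ (i : ℕ) < e then 1 else 0

/-- The objective function `trace (A X B Xᵀ)`. -/
def objective {c d : ℕ} (A : Matrix (Fin c) (Fin c) ℝ) (B : Matrix (Fin d) (Fin d) ℝ)
    (X : Matrix (Fin c) (Fin d) ℝ) : ℝ :=
  (A * X * B * X.transpose).trace

/-- The set of all maximizers of `f` over `S`. -/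
def argmaxOn {α : Type*} (f : α → ℝ) (S : Set α) : Set α :=
  {x | x ∈ S ∧ ∀ y ∈ S, f y ≤ f x}

/-- The random variable indicating adjacency of `i` and `j` in the random graph `G`. -/
def adjInd {Ω : Type*} {k : ℕ} (G : Ω → SimpleGraph (Fin k)) (i j : Fin k) (ω : Ω) : ℝ :=
  open Classical in
  if (G ω).Adj i j then 1 else 0

/-- The Pearson correlation coefficient of two real random variables of positive variance. -/
def pearson {Ω : Type*} [MeasurableSpace Ω] (μ : Measure Ω) (X Y : Ω → ℝ) : ℝ :=
  cov[X, Y; μ] / (√(Var[X; μ]) * √(Var[Y; μ]))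

/-- The pairs of vertices `i < j` of the core. -/
abbrev CorePair (K : ℕ) : Type := {e : Fin K × Fin K // e.1 < e.2}

/-- The pairs of vertices `i < j` that do not both belong to the core. -/
abbrev OuterPair (K k : ℕ) : Type := {e : Fin k × Fin k // e.1 < e.2 ∧ K ≤ (e.2 : ℕ)}

/-- The blocks of adjacencies that are collectively independent: one block of two adjacencies (one
in `G`, one in `H`) for each core pair, and a block of one adjacency for every pair of vertices of
`G`, and for every pair of vertices of `H`, that is not a core pair. The unused coordinate in a block
of one adjacency is `0`. -/
def block {Ω : Type*} {m n K : ℕ} (hm : K ≤ m) (hn : K ≤ n)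
    (G : Ω → SimpleGraph (Fin m)) (H : Ω → SimpleGraph (Fin n)) :
    CorePair K ⊕ (OuterPair K m ⊕ OuterPair K n) → Ω → ℝ × ℝ
  | Sum.inl e => fun ω =>
      (adjInd G (Fin.castLE hm e.1.1) (Fin.castLE hm e.1.2) ω,
        adjInd H (Fin.castLE hn e.1.1) (Fin.castLE hn e.1.2) ω)
  | Sum.inr (Sum.inl e) => fun ω => (adjInd G e.1.1 e.1.2 ω, 0)
  | Sum.inr (Sum.inr e) => fun ω => (0, adjInd H e.1.1 e.1.2 ω)

/-- `(G, H)` are correlated Bernoulli random graphs with parameters `m, n, K, p, ρ`. Only the values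
`p i j` with `i < j < max m n` and `ρ i j` with `i < j < K` matter. -/
structure IsCorrelatedBernoulli {Ω : Type*} [MeasurableSpace Ω] (μ : Measure Ω) (m n K : ℕ)
    (p ρ : ℕ → ℕ → ℝ) (G : Ω → SimpleGraph (Fin m)) (H : Ω → SimpleGraph (Fin n)) : Prop where
  core_pos : 1 ≤ K
  core_le_left : K ≤ m
  core_le_right : K ≤ n
  p_mem : ∀ i j, i < j → j < max m n → p i j ∈ Set.Icc (0 : ℝ) 1
  ρ_mem : ∀ i j, i < j → j < K → ρ i j ∈ Set.Icc (0 : ℝ) 1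
  measurable_left : ∀ i j, MeasurableSet {ω | (G ω).Adj i j}
  measurable_right : ∀ i j, MeasurableSet {ω | (H ω).Adj i j}
  prob_left : ∀ i j : Fin m, i < j → μ.real {ω | (G ω).Adj i j} = p i j
  prob_right : ∀ i j : Fin n, i < j → μ.real {ω | (H ω).Adj i j} = p i j
  correlation : ∀ i j : Fin K, i < j →
    pearson μ (adjInd G (Fin.castLE core_le_left i) (Fin.castLE core_le_left j))
      (adjInd H (Fin.castLE core_le_right i) (Fin.castLE core_le_right j)) = ρ i j
  independent : iIndepFun (block core_le_left core_le_right G H) μ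

/-- The margin `ε = min_{i < j < K} (ρ i j - (1 - 2 q)²)`. The set is finite, so the infimum is a
minimum if `K ≥ 2`; if `K ≤ 1` there are no such pairs, and the value is `0`. -/
def margin (q : ℝ) (K : ℕ) (ρ : ℕ → ℕ → ℝ) : ℝ :=
  sInf {x | ∃ i j, i < j ∧ j < K ∧ x = ρ i j - (1 - 2 * q) ^ 2}

end

end SubgraphMatching

namespace SubgraphMatching

/-! Write C for the set of positions of the ones of the core matrix, and `overlap A B P Q` for the
value of the bilinear form behind the objective at the indicator matrices of two matchings P, Q with
K positions each.

Deterministic half. The relaxation lies in the convex hull of the partial permutation matrices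
(`relaxedPolytope_subset_convexHull`, from Birkhoff's theorem for a doubly stochastic completion).
The quadratic objective need be neither convex nor concave, so beating single vertices of the hull
is not enough. It is enough that (C, C) beats every other pair (P, Q), since linearity in each
argument separately carries the strict inequality over to the hull
(`quadratic_lt_of_mem_convexHull`). This leaves finitely many inequalities.

Probabilistic half. Fix (P, Q) and put k = |C \ P| + |C \ Q|. After cancellation, the difference of
the overlaps of (C, C) and (P, Q) has at most 2Kk terms, each a product of a sign of G and a sign of
H. Such a product has mean at least (1-2q)² + ε for corresponding core adjacencies and at most
(1-2q)² for independent ones. Apart from O(k) exceptional terms the two kinds face each other one to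
one, so the difference has mean at least kKε/4 once Kε ≥ 8 (`le_integral_overlap_sub`). Each
independent block enters boundedly many terms, so McDiarmid's inequality bounds the probability that
(P, Q) wins by exp(-kKε²/1024) (`measure_overlap_le`).

Choosing (P, Q) at distance k from C costs only a factor exp(O(k log N)), which the hypothesis ε²K /
log N → ∞ absorbs. The union bound is then O(N⁻²) (`measure_mismatchEvent_le`), which is summable,
and the first Borel–Cantelli lemma, which needs no independence between different N, finishes. -/

/-! ### The relaxation and Birkhoff's theorem. -/

/-- The doubly stochastic completion of a matrix in `relaxedPolytope c d e`. -/
noncomputable def completion {c d : ℕ} (e : ℕ) (X : Matrix (Fin c) (Fin d) ℝ) :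
    Matrix (Fin c ⊕ Fin (d - e)) (Fin d ⊕ Fin (c - e)) ℝ :=
  Matrix.fromBlocks X (Matrix.of fun i _ => (1 - ∑ j, X i j) / ((c - e : ℕ) : ℝ))
    (Matrix.of fun _ j => (1 - ∑ i, X i j) / ((d - e : ℕ) : ℝ)) 0

/-- If c = e there is nothing to distribute and the quotient is the default 0, but then numbers at
most 1 with total c are all equal to 1. -/
lemma fill_line {c e : ℕ} (hc : e ≤ c) (r : Fin c → ℝ) (hr : ∀ i, r i ≤ 1)
    (hs : ∑ i, r i = (e : ℝ)) (i : Fin c) :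
    r i + ((c - e : ℕ) : ℝ) * ((1 - r i) / ((c - e : ℕ) : ℝ)) = 1 := by
  by_cases h : c - e = 0
  · have hce : c = e := by omega
    have h0 : ∑ i, (1 - r i) = 0 := by simp [hs, hce]
    have := (Finset.sum_eq_zero_iff_of_nonneg (fun i _ => sub_nonneg.2 (hr i))).1 h0 i
      (Finset.mem_univ i)
    simp only [h, Nat.cast_zero, zero_mul]
    linarith
  · have : ((c - e : ℕ) : ℝ) ≠ 0 := by exact_mod_cast h
    field_simp
    ring

lemma fill_total {c e : ℕ} (hc : e ≤ c) (h : c - e ≠ 0) (r : Fin c → ℝ)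
    (hs : ∑ i, r i = (e : ℝ)) :
    ∑ i, (1 - r i) / ((c - e : ℕ) : ℝ) = 1 := by
  have h' : ((c - e : ℕ) : ℝ) ≠ 0 := by exact_mod_cast h
  rw [← Finset.sum_div, Finset.sum_sub_distrib, hs, div_eq_one_iff_eq h']
  simp [Nat.cast_sub hc]

lemma completion_nonneg {c d e : ℕ} {X : Matrix (Fin c) (Fin d) ℝ}
    (hX : X ∈ relaxedPolytope c d e) (i j) : 0 ≤ completion e X i j := by
  obtain ⟨h0, h1, h2, -⟩ := hX
  rcases i with i | i <;> rcases j with j | j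
  · exact h0 i j
  · exact div_nonneg (sub_nonneg.2 (h1 i)) (Nat.cast_nonneg _)
  · exact div_nonneg (sub_nonneg.2 (h2 j)) (Nat.cast_nonneg _)
  · simp [completion]

lemma completion_row_sum {c d e : ℕ} (hc : e ≤ c) (hd : e ≤ d) {X : Matrix (Fin c) (Fin d) ℝ}
    (hX : X ∈ relaxedPolytope c d e) (i) : ∑ j, completion e X i j = 1 := by
  obtain ⟨h0, h1, h2, h3⟩ := hX
  rcases i with i | i
  · simpa [completion] using fill_line hc (fun i => ∑ j, X i j) h1 h3 i
  · simpa [completion] using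
      fill_total hd (by have := i.2; omega) (fun j => ∑ i, X i j) (Finset.sum_comm.trans h3)

lemma completion_col_sum {c d e : ℕ} (hc : e ≤ c) (hd : e ≤ d) {X : Matrix (Fin c) (Fin d) ℝ}
    (hX : X ∈ relaxedPolytope c d e) (j) : ∑ i, completion e X i j = 1 := by
  obtain ⟨h0, h1, h2, h3⟩ := hX
  rcases j with j | j
  · simpa [completion] using
      fill_line hd (fun j => ∑ i, X i j) h2 (Finset.sum_comm.trans h3) j
  · simpa [completion] using fill_total hc (by have := j.2; omega) (fun i => ∑ j, X i j) h3

/-- Every matrix of the relaxation is a convex combination of partial permutation matrices. -/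
theorem relaxedPolytope_subset_convexHull {c d e : ℕ} (hc : e ≤ c) (hd : e ≤ d) :
    relaxedPolytope c d e ⊆ convexHull ℝ (partialPerms c d e) := by
  intro X hX
  have hcard : Fintype.card (Fin c ⊕ Fin (d - e)) = Fintype.card (Fin d ⊕ Fin (c - e)) := by
    simp only [Fintype.card_sum, Fintype.card_fin]; omega
  -- Birkhoff's theorem needs one index type for rows and columns; both types here have c + d - e
  -- elements.
  let σ := Fintype.equivOfCardEq hcard
  obtain ⟨w, hw0, hw1, hw⟩ := exists_eq_sum_perm_of_mem_doublyStochastic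
    (M := (completion e X).submatrix id σ) (by
      rw [mem_doublyStochastic_iff_sum]
      refine ⟨fun i j => completion_nonneg hX _ _, fun i => ?_, fun j => ?_⟩
      · simpa [σ.sum_comp] using completion_row_sum hc hd hX i
      · simpa using completion_col_sum hc hd hX (σ j))
  let P (π : Equiv.Perm (Fin c ⊕ Fin (d - e))) :
      Matrix (Fin c ⊕ Fin (d - e)) (Fin d ⊕ Fin (c - e)) ℝ := fun i j => if σ (π i) = j then 1 else 0
  have hP : ∀ i j, ∑ π, w π * P π i j = completion e X i j := by
    intro i j
    have := congr_fun (congr_fun hw i) (σ.symm j)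
    rw [Matrix.sum_apply] at this
    simp only [Matrix.submatrix_apply, id, Equiv.apply_symm_apply] at this
    rw [← this]
    refine Finset.sum_congr rfl fun π _ => ?_
    simp [P, Equiv.toPEquiv_apply, PEquiv.toMatrix_apply, Equiv.symm_apply_eq, eq_comm]
  have hrow : ∀ π i, ∑ j, P π i j = 1 := fun π i => by simp [P]
  have hcol : ∀ π j, ∑ i, P π i j = 1 := fun π j => by
    rw [Fintype.sum_eq_single ((π.trans σ).symm j)]
    · simp [P]
    · intro i hi
      have : σ (π i) ≠ j := fun h => hi (by rw [← h]; simp)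
      simp [P, this]
  have hnn : ∀ π i j, 0 ≤ P π i j := fun π i j => by simp only [P]; split_ifs <;> norm_num
  -- Permutations of weight zero are dropped because only those of nonzero weight inherit the zero
  -- lower right block.
  have hXeq : X = ∑ π with w π ≠ 0, w π • (P π).toBlocks₁₁ := by
    ext i j
    refine (hP (Sum.inl i) (Sum.inl j)).symm.trans ?_
    rw [Matrix.sum_apply]
    exact (Finset.sum_filter_of_ne (p := fun π => w π ≠ 0) fun π _ h h0 => h (by simp [h0])).symm
  rw [hXeq]
  refine (convex_convexHull ℝ _).sum_mem (fun π _ => hw0 π) ?_ fun π hπ =>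
    subset_convexHull ℝ _ ?_
  · rw [← hw1]
    exact Finset.sum_filter_ne_zero _
  · have hwπ : w π ≠ 0 := (Finset.mem_filter.1 hπ).2
    have hzero : ∀ i j, P π (Sum.inr i) (Sum.inr j) = 0 := by
      intro i j
      have h := hP (Sum.inr i) (Sum.inr j)
      rw [show completion e X (Sum.inr i) (Sum.inr j) = 0 by simp [completion],
        Finset.sum_eq_zero_iff_of_nonneg (fun π _ => mul_nonneg (hw0 π) (hnn π _ _))] at h
      exact (mul_eq_zero.1 (h π (Finset.mem_univ π))).resolve_left hwπ
    refine ⟨fun i j => ?_, fun i => ?_, fun j => ?_, ?_⟩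
    · simp only [Matrix.toBlocks₁₁, Matrix.of_apply, P]
      split_ifs <;> simp
    · have h := hrow π (Sum.inl i)
      rw [Fintype.sum_sum_type] at h
      have := Finset.sum_nonneg fun (j : Fin (c - e)) (_ : j ∈ Finset.univ) =>
        hnn π (Sum.inl i) (Sum.inr j)
      simp only [Matrix.toBlocks₁₁, Matrix.of_apply]
      linarith
    · have h := hcol π (Sum.inl j)
      rw [Fintype.sum_sum_type] at h
      have := Finset.sum_nonneg fun (i : Fin (d - e)) (_ : i ∈ Finset.univ) =>
        hnn π (Sum.inr i) (Sum.inl j)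
      simp only [Matrix.toBlocks₁₁, Matrix.of_apply]
      linarith
    · have h1 : ∑ i, ∑ j, P π (Sum.inl i) j = c := by simp [hrow]
      have h2 : ∑ j, ∑ i, P π i (Sum.inr j) = ((c - e : ℕ) : ℝ) := by simp [hcol]
      simp only [Fintype.sum_sum_type, Finset.sum_add_distrib, hzero, Finset.sum_const_zero,
        add_zero] at h1 h2
      rw [Finset.sum_comm] at h2
      rw [Nat.cast_sub hc] at h2
      simp only [Matrix.toBlocks₁₁, Matrix.of_apply]
      linarith

/-! ### Bilinear forms on a convex hull. -/

/-- An open half-space together with one point of its closure is convex. -/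
lemma lt_or_eq_of_mem_convexHull {E : Type*} [AddCommGroup E] [Module ℝ E] {S : Set E}
    (L : E →ₗ[ℝ] ℝ) (a : ℝ) (z : E) (hz : L z ≤ a) (hS : ∀ x ∈ S, x ≠ z → L x < a) {x : E}
    (hx : x ∈ convexHull ℝ S) : L x < a ∨ x = z := by
  have hconv : Convex ℝ {x | L x < a ∨ x = z} := by
    rw [convex_iff_forall_pos]
    intro x hx y hy s t hs ht hst
    have hle : ∀ x, (L x < a ∨ x = z) → L x ≤ a := by
      rintro x (h | rfl)
      exacts [h.le, hz]
    have hx' := hle x hx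
    have hy' := hle y hy
    have key : L (s • x + t • y) = s * L x + t * L y := by simp
    have hsx : s * L x ≤ s * a := mul_le_mul_of_nonneg_left hx' hs.le
    have hty : t * L y ≤ t * a := mul_le_mul_of_nonneg_left hy' ht.le
    have hsum : s * a + t * a = a := by rw [← add_mul, hst, one_mul]
    rcases hx with hx | rfl
    · left
      have := mul_lt_mul_of_pos_left hx hs
      linarith
    · rcases hy with hy | rfl
      · left
        have := mul_lt_mul_of_pos_left hy ht
        linarith
      · right; rw [← add_smul, hst, one_smul]
  exact convexHull_min (fun x hx => by
    by_cases h : x = z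
    · exact Or.inr h
    · exact Or.inl (hS x hx h)) hconv hx

/-- If a bilinear form is smaller at every other pair of points of `S` than at `(z, z)`, then on the
convex hull of `S` its quadratic form is maximal exactly at `z`. -/
lemma quadratic_lt_of_mem_convexHull {E : Type*} [AddCommGroup E] [Module ℝ E] {S : Set E}
    (g : E →ₗ[ℝ] E →ₗ[ℝ] ℝ) {z : E} (hzS : z ∈ S)
    (hS : ∀ x ∈ S, ∀ y ∈ S, (x, y) ≠ (z, z) → g x y < g z z) {x : E}
    (hx : x ∈ convexHull ℝ S) (hxz : x ≠ z) : g x x < g z z := by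
  -- The second argument moves from z to x while the first stays at z; afterwards the first moves
  -- while the second stays at x.
  have hz : g z x < g z z :=
    (lt_or_eq_of_mem_convexHull (g z) (g z z) z le_rfl
      (fun y hy hyz => hS z hzS y hy (by simp [hyz])) hx).resolve_right hxz
  refine (lt_or_eq_of_mem_convexHull (g.flip x) (g z z) z hz.le (fun y hy hyz => ?_)
    hx).resolve_right hxz
  exact (lt_or_eq_of_mem_convexHull (g y) (g z z) z
    (hS y hy z hzS (by simp [hyz])).le (fun u hu _ => hS y hy u hu (by simp [hyz])) hx).elim id
    fun h => absurd h hxz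

/-! ### Bounded differences. -/

/-- McDiarmid's inequality, in its exponential moment form, for product measures. -/
theorem integral_exp_le_of_bounded_differences {β : Type*} [Finite β] [MeasurableSpace β]
    [MeasurableSingletonClass β] :
    ∀ (n : ℕ) (ν : Fin n → Measure β) [∀ i, IsProbabilityMeasure (ν i)]
      (F : (Fin n → β) → ℝ) (c : Fin n → ℝ),
      (∀ i x y, (∀ j, j ≠ i → x j = y j) → F x - F y ≤ 2 * c i) → ∀ t : ℝ,
      ∫ x, Real.exp (t * F x) ∂(Measure.pi ν) ≤
        Real.exp (t * ∫ x, F x ∂(Measure.pi ν) + (∑ i, c i ^ 2) * t ^ 2 / 2)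
  | 0, ν, _, F, c, _, t => by
    have : ∀ x, F x = F default := fun x => congr_arg F (Subsingleton.elim _ _)
    simp only [this]
    simp
  | n + 1, ν, _, F, c, h, t => by
    have hsplit : ∀ f : (Fin (n + 1) → β) → ℝ, ∫ x, f x ∂(Measure.pi ν) =
        ∫ b, ∫ y, f (Fin.cons b y) ∂(Measure.pi fun j : Fin n => ν j.succ) ∂(ν 0) := by
      intro f
      have hmp := (measurePreserving_piFinSuccAbove ν 0).symm
      rw [← hmp.integral_comp', integral_prod]
      · simp [MeasurableEquiv.piFinSuccAbove, Fin.insertNthEquiv]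
      · exact Integrable.of_finite
    set π := Measure.pi fun j : Fin n => ν j.succ with hπ
    set g : β → ℝ := fun b => ∫ y, F (Fin.cons b y) ∂π with hg
    -- Induction applies with the first coordinate frozen. The conditional mean `g` then oscillates
    -- by at most `2 * c 0`, and Hoeffding's lemma handles it.
    have hinner : ∀ b, ∫ y, Real.exp (t * F (Fin.cons b y)) ∂π ≤
        Real.exp (t * g b + (∑ i : Fin n, c i.succ ^ 2) * t ^ 2 / 2) := by
      intro b
      refine integral_exp_le_of_bounded_differences n (fun j => ν j.succ)
        (fun y => F (Fin.cons b y)) (fun i => c i.succ) (fun i x y hxy => h _ _ _ fun j hj => ?_) t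
      refine Fin.cases (fun _ => rfl) (fun j hj => ?_) j hj
      simpa using hxy j (fun e => hj (by rw [e]))
    have hgdiff : ∀ a b, g a - g b ≤ 2 * c 0 := by
      intro a b
      rw [hg, ← integral_sub Integrable.of_finite Integrable.of_finite]
      calc _ ≤ ∫ _, 2 * c 0 ∂π := by
            refine integral_mono Integrable.of_finite Integrable.of_finite fun y => h 0 _ _ ?_
            intro j hj
            obtain ⟨k, rfl⟩ := Fin.exists_succ_eq.2 hj
            simp
        _ = _ := by simp
    have : Nonempty β := nonempty_of_isProbabilityMeasure (ν 0)
    obtain ⟨a, ha⟩ := Finite.exists_min g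
    have hsub := (hasSubgaussianMGF_of_mem_Icc (μ := ν 0) (X := g) (a := g a) (b := g a + 2 * c 0)
      (measurable_of_finite g).aemeasurable
      (Filter.Eventually.of_forall fun b => ⟨ha b, by linarith [hgdiff b a]⟩)).mgf_le t
    have hc : ((‖g a + 2 * c 0 - g a‖₊ / 2 : NNReal) : ℝ) ^ 2 = c 0 ^ 2 := by
      simp
    have houter : ∫ b, Real.exp (t * g b) ∂(ν 0) ≤
        Real.exp (t * ∫ b, g b ∂(ν 0) + c 0 ^ 2 * t ^ 2 / 2) := by
      rw [NNReal.coe_pow, hc] at hsub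
      simp only [mgf, mul_sub, Real.exp_sub, integral_div] at hsub
      rw [div_le_iff₀ (Real.exp_pos _), ← Real.exp_add] at hsub
      exact hsub.trans_eq (congr_arg Real.exp (add_comm _ _))
    rw [hsplit, hsplit F]
    calc _ ≤ ∫ b, Real.exp ((∑ i : Fin n, c i.succ ^ 2) * t ^ 2 / 2) * Real.exp (t * g b) ∂(ν 0) := by
          refine integral_mono Integrable.of_finite Integrable.of_finite fun b => ?_
          refine (hinner b).trans_eq ?_
          rw [← Real.exp_add, add_comm]
      _ ≤ Real.exp ((∑ i : Fin n, c i.succ ^ 2) * t ^ 2 / 2) *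
            Real.exp (t * ∫ b, g b ∂(ν 0) + c 0 ^ 2 * t ^ 2 / 2) := by
          rw [integral_const_mul]
          gcongr
      _ = _ := by
          rw [← Real.exp_add, Fin.sum_univ_succ]
          congr 1
          ring

/-- McDiarmid's inequality: a function with bounded differences of finitely many independent
random variables is sub-Gaussian. -/
theorem hasSubgaussianMGF_of_bounded_differences {Ω ι β : Type*} [MeasurableSpace Ω]
    {μ : Measure Ω} [IsProbabilityMeasure μ] [Fintype ι] [Finite β] [MeasurableSpace β]
    [MeasurableSingletonClass β] {ξ : ι → Ω → β} (hξ : iIndepFun ξ μ)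
    (hm : ∀ i, Measurable (ξ i)) (F : (ι → β) → ℝ) (c : ι → ℝ)
    (h : ∀ i x y, (∀ j, j ≠ i → x j = y j) → F x - F y ≤ 2 * c i) :
    HasSubgaussianMGF (fun ω => F (fun i => ξ i ω) - ∫ ω, F (fun i => ξ i ω) ∂μ)
      (∑ i, c i ^ 2).toNNReal μ := by
  let e := (Fintype.equivFin ι).symm
  let ξ' : Fin (Fintype.card ι) → Ω → β := fun k => ξ (e k)
  have hm' : ∀ k, Measurable (ξ' k) := fun k => hm _
  have hind : iIndepFun ξ' μ := hξ.precomp e.injective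
  have hmap := (iIndepFun_iff_map_fun_eq_pi_map fun k => (hm' k).aemeasurable).1 hind
  have hmeas : Measurable fun ω k => ξ' k ω := measurable_pi_lambda _ hm'
  have : ∀ k, IsProbabilityMeasure (μ.map (ξ' k)) :=
    fun k => Measure.isProbabilityMeasure_map (hm' k).aemeasurable
  have htr : ∀ f : (ι → β) → ℝ, ∫ ω, f (fun i => ξ i ω) ∂μ =
      ∫ x, f (fun i => x (e.symm i)) ∂(Measure.pi fun k => μ.map (ξ' k)) := by
    intro f
    rw [← hmap, integral_map hmeas.aemeasurable (measurable_of_finite _).aestronglyMeasurable]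
    simp [ξ']
  have hmgf := integral_exp_le_of_bounded_differences _ (fun k => μ.map (ξ' k))
    (fun x => F fun i => x (e.symm i)) (fun k => c (e k)) (fun k x y hxy => by
      simpa using h (e k) (fun i => x (e.symm i)) (fun i => y (e.symm i)) fun j hj =>
        hxy _ fun hk => hj (by rw [← hk, e.apply_symm_apply]))
  have hξm : Measurable fun ω i => ξ i ω := measurable_pi_lambda _ hm
  constructor
  · intro t
    obtain ⟨C, hC⟩ := (Set.finite_range fun x : ι → β =>
      Real.exp (t * (F x - ∫ ω, F (fun i => ξ i ω) ∂μ))).bddAbove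
    refine Integrable.of_bound
      (((measurable_of_finite fun x : ι → β =>
        Real.exp (t * (F x - ∫ ω, F (fun i => ξ i ω) ∂μ))).comp hξm).aestronglyMeasurable) C
      (Filter.Eventually.of_forall fun ω => ?_)
    rw [Real.norm_of_nonneg (Real.exp_pos _).le]
    exact hC ⟨_, rfl⟩
  · intro t
    have h1 := hmgf t
    rw [← htr F, ← htr fun x => Real.exp (t * F x)] at h1
    simp only [mgf, mul_sub, Real.exp_sub, integral_div]
    rw [div_le_iff₀ (Real.exp_pos _), ← Real.exp_add,
      Real.coe_toNNReal _ (Finset.sum_nonneg fun i _ => sq_nonneg _), add_comm,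
      ← e.sum_comp fun i => c i ^ 2]
    exact h1

open Classical in
/-- Lower tail of a sum of bounded terms, each of which depends on at most two of finitely many
independent random variables, each variable occurring in at most `r` terms. -/
theorem measure_sum_nonpos_le {Ω ι β κ : Type*} [MeasurableSpace Ω]
    {μ : Measure Ω} [IsProbabilityMeasure μ] [Fintype ι] [Finite β] [MeasurableSpace β]
    [MeasurableSingletonClass β] {ξ : ι → Ω → β} (hξ : iIndepFun ξ μ)
    (hm : ∀ i, Measurable (ξ i)) (T : Finset κ) (φ : κ → (ι → β) → ℝ)
    (hφ : ∀ τ x, |φ τ x| ≤ 1) (D : ι → κ → Prop)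
    (hD : ∀ b τ x y, ¬ D b τ → (∀ j, j ≠ b → x j = y j) → φ τ x = φ τ y)
    (hD2 : ∀ τ ∈ T, (Finset.univ.filter fun b => D b τ).card ≤ 2)
    (r : ℕ) (hr : ∀ b, (T.filter fun τ => D b τ).card ≤ r)
    (hE : 0 ≤ ∫ ω, ∑ τ ∈ T, φ τ (fun i => ξ i ω) ∂μ) :
    μ.real {ω | ∑ τ ∈ T, φ τ (fun i => ξ i ω) ≤ 0} ≤
      Real.exp (-(∫ ω, ∑ τ ∈ T, φ τ (fun i => ξ i ω) ∂μ) ^ 2 / (4 * r * T.card)) := by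
  set N : ι → ℕ := fun b => (T.filter fun τ => D b τ).card with hN
  have hbd : ∀ i x y, (∀ j, j ≠ i → x j = y j) →
      ∑ τ ∈ T, φ τ x - ∑ τ ∈ T, φ τ y ≤ 2 * (N i : ℝ) := by
    intro i x y hxy
    rw [← Finset.sum_sub_distrib]
    calc ∑ τ ∈ T, (φ τ x - φ τ y) ≤ ∑ τ ∈ T, if D i τ then (2 : ℝ) else 0 := by
          refine Finset.sum_le_sum fun τ _ => ?_
          split_ifs with h
          · have h1 := abs_le.1 (hφ τ x)
            have h2 := abs_le.1 (hφ τ y)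
            linarith
          · rw [hD i τ x y h hxy, sub_self]
      _ = _ := by
          rw [← Finset.sum_filter, Finset.sum_const, nsmul_eq_mul, mul_comm]
  -- Double counting of the incidences between variables and terms.
  have hsumN : ∑ b, N b ≤ 2 * T.card := by
    simp only [hN, Finset.card_filter]
    rw [Finset.sum_comm]
    simp only [← Finset.card_filter]
    calc _ ≤ ∑ τ ∈ T, 2 := Finset.sum_le_sum hD2
      _ = _ := by simp [mul_comm]
  have hsq : ∑ b, (N b : ℝ) ^ 2 ≤ 2 * r * T.card := by
    have : ∑ b, N b ^ 2 ≤ 2 * r * T.card :=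
      calc ∑ b, N b ^ 2 ≤ ∑ b, r * N b :=
            Finset.sum_le_sum fun b _ => by rw [sq]; exact Nat.mul_le_mul_right _ (hr b)
        _ = r * ∑ b, N b := by rw [Finset.mul_sum]
        _ ≤ r * (2 * T.card) := Nat.mul_le_mul_left _ hsumN
        _ = _ := by ring
    exact_mod_cast this
  have hsub := hasSubgaussianMGF_of_bounded_differences hξ hm (fun x => ∑ τ ∈ T, φ τ x)
    (fun b => (N b : ℝ)) hbd
  set EF := ∫ ω, ∑ τ ∈ T, φ τ (fun i => ξ i ω) ∂μ with hEF
  -- The variance proxy ∑ N² ≤ r ∑ N ≤ 2r|T| may be enlarged to its bound.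
  have hsub' : HasSubgaussianMGF (-fun ω => ∑ τ ∈ T, φ τ (fun i => ξ i ω) - EF)
      (2 * r * T.card : ℝ).toNNReal μ := by
    refine ⟨hsub.neg.1, fun t => (hsub.neg.2 t).trans (Real.exp_le_exp.2 ?_)⟩
    gcongr
  have h := hsub'.measure_ge_le hE
  rw [Real.coe_toNNReal _ (by positivity)] at h
  refine le_trans (measureReal_mono fun ω hω => ?_) (h.trans_eq ?_)
  · simp only [Set.mem_ofPred_eq, Pi.neg_apply] at hω ⊢
    linarith
  · congr 2
    ring

/-! ### Encoding the adjacencies by independent blocks. -/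

section

/-- The index type of the independent blocks of adjacencies. -/
abbrev BlockIndex (m n K : ℕ) : Type := CorePair K ⊕ (OuterPair K m ⊕ OuterPair K n)

/-- The block `b` contains the adjacency of `i` and `j` in the left graph. -/
def TouchesLeft {m n K : ℕ} : BlockIndex m n K → Fin m → Fin m → Prop
  | Sum.inl e, i, j => s((e.1.1 : ℕ), (e.1.2 : ℕ)) = s((i : ℕ), (j : ℕ))
  | Sum.inr (Sum.inl e), i, j => s((e.1.1 : ℕ), (e.1.2 : ℕ)) = s((i : ℕ), (j : ℕ))
  | Sum.inr (Sum.inr _), _, _ => False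

/-- The block `b` contains the adjacency of `i` and `j` in the right graph. -/
def TouchesRight {m n K : ℕ} : BlockIndex m n K → Fin n → Fin n → Prop
  | Sum.inl e, i, j => s((e.1.1 : ℕ), (e.1.2 : ℕ)) = s((i : ℕ), (j : ℕ))
  | Sum.inr (Sum.inl _), _, _ => False
  | Sum.inr (Sum.inr e), i, j => s((e.1.1 : ℕ), (e.1.2 : ℕ)) = s((i : ℕ), (j : ℕ))

/-- The pair of vertices of a block. -/
def blockPair {m n K : ℕ} : BlockIndex m n K → Sym2 ℕ
  | Sum.inl e => s((e.1.1 : ℕ), (e.1.2 : ℕ))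
  | Sum.inr (Sum.inl e) => s((e.1.1 : ℕ), (e.1.2 : ℕ))
  | Sum.inr (Sum.inr e) => s((e.1.1 : ℕ), (e.1.2 : ℕ))

variable {m n K : ℕ}

lemma TouchesLeft.pair_eq {b : BlockIndex m n K} {i j : Fin m} (h : TouchesLeft b i j) :
    blockPair b = s((i : ℕ), (j : ℕ)) := by
  rcases b with e | e | e
  exacts [h, h, h.elim]

lemma TouchesRight.pair_eq {b : BlockIndex m n K} {i j : Fin n} (h : TouchesRight b i j) :
    blockPair b = s((i : ℕ), (j : ℕ)) := by
  rcases b with e | e | e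
  exacts [h, h.elim, h]

lemma TouchesLeft.symm {b : BlockIndex m n K} {i j : Fin m} (h : TouchesLeft b i j) :
    TouchesLeft b j i := by
  rcases b with e | e | e
  exacts [Eq.trans h Sym2.eq_swap, Eq.trans h Sym2.eq_swap, h]

lemma TouchesRight.symm {b : BlockIndex m n K} {i j : Fin n} (h : TouchesRight b i j) :
    TouchesRight b j i := by
  rcases b with e | e | e
  exacts [Eq.trans h Sym2.eq_swap, h, Eq.trans h Sym2.eq_swap]

lemma TouchesLeft.ne {b : BlockIndex m n K} {i j : Fin m} (h : TouchesLeft b i j) : i ≠ j := by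
  rintro rfl
  rcases b with ⟨e, he⟩ | ⟨e, he⟩ | e
  · simp only [TouchesLeft, Sym2.eq_iff, Fin.lt_def] at h he; omega
  · simp only [TouchesLeft, Sym2.eq_iff, Fin.lt_def] at h he; omega
  · exact h

lemma TouchesRight.ne {b : BlockIndex m n K} {i j : Fin n} (h : TouchesRight b i j) : i ≠ j := by
  rintro rfl
  rcases b with ⟨e, he⟩ | e | ⟨e, he⟩
  · simp only [TouchesRight, Sym2.eq_iff, Fin.lt_def] at h he; omega
  · exact h
  · simp only [TouchesRight, Sym2.eq_iff, Fin.lt_def] at h he; omega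

/-- Core and outer blocks cannot share a pair, because the larger vertex is below K in the former
and not in the latter; within one kind the order of the two vertices fixes the block. -/
lemma TouchesLeft.unique {b b' : BlockIndex m n K} {i j : Fin m} (h : TouchesLeft b i j)
    (h' : TouchesLeft b' i j) : b = b' := by
  rcases b with ⟨⟨e, f⟩, he⟩ | ⟨⟨e, f⟩, he⟩ | e <;>
    rcases b' with ⟨⟨e', f'⟩, he'⟩ | ⟨⟨e', f'⟩, he'⟩ | e' <;>
    (try have hlt := he) <;> (try have hlt' := he') <;>
    simp only [TouchesLeft, Sym2.eq_iff, Fin.lt_def, Sum.inl.injEq, Sum.inr.injEq, Subtype.mk.injEq,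
      Prod.mk.injEq, Fin.ext_iff] at * <;> omega

lemma TouchesRight.unique {b b' : BlockIndex m n K} {i j : Fin n} (h : TouchesRight b i j)
    (h' : TouchesRight b' i j) : b = b' := by
  rcases b with ⟨⟨e, f⟩, he⟩ | e | ⟨⟨e, f⟩, he⟩ <;>
    rcases b' with ⟨⟨e', f'⟩, he'⟩ | e' | ⟨⟨e', f'⟩, he'⟩ <;>
    (try have hlt := he) <;> (try have hlt' := he') <;>
    simp only [TouchesRight, Sym2.eq_iff, Fin.lt_def, Sum.inl.injEq, Sum.inr.injEq, Subtype.mk.injEq,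
      Prod.mk.injEq, Fin.ext_iff] at * <;> omega

lemma exists_touchesLeft {i j : Fin m} (hij : i ≠ j) : ∃ b : BlockIndex m n K, TouchesLeft b i j := by
  wlog h : i < j generalizing i j
  · obtain ⟨b, hb⟩ := this hij.symm (lt_of_le_of_ne (not_lt.1 h) hij.symm)
    exact ⟨b, hb.symm⟩
  by_cases hj : (j : ℕ) < K
  · exact ⟨Sum.inl ⟨(⟨i, lt_trans h hj⟩, ⟨j, hj⟩), h⟩, rfl⟩
  · exact ⟨Sum.inr (Sum.inl ⟨(i, j), h, not_lt.1 hj⟩), rfl⟩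

lemma exists_touchesRight {i j : Fin n} (hij : i ≠ j) :
    ∃ b : BlockIndex m n K, TouchesRight b i j := by
  wlog h : i < j generalizing i j
  · obtain ⟨b, hb⟩ := this hij.symm (lt_of_le_of_ne (not_lt.1 h) hij.symm)
    exact ⟨b, hb.symm⟩
  by_cases hj : (j : ℕ) < K
  · exact ⟨Sum.inl ⟨(⟨i, lt_trans h hj⟩, ⟨j, hj⟩), h⟩, rfl⟩
  · exact ⟨Sum.inr (Sum.inr ⟨(i, j), h, not_lt.1 hj⟩), rfl⟩

/-- A block that contains adjacencies of both graphs belongs to a core pair. -/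
lemma TouchesLeft.lt_of_touchesRight {b : BlockIndex m n K} {i j : Fin m} {u v : Fin n}
    (h : TouchesLeft b i j) (h' : TouchesRight b u v) : (i : ℕ) < K ∧ (j : ℕ) < K := by
  rcases b with ⟨⟨e, f⟩, he⟩ | e | e
  · simp only [TouchesLeft, Sym2.eq_iff] at h; omega
  · exact h'.elim
  · exact h.elim

/-- The sign encoding the adjacency of `i` and `j` in the left graph, as a function of the state of
all blocks. -/
noncomputable def leftSign (x : BlockIndex m n K → Bool × Bool) (i j : Fin m) : ℝ :=
  open Classical in
  if h : ∃ b : BlockIndex m n K, TouchesLeft b i j then if (x h.choose).1 then 1 else -1 else 0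

/-- The sign encoding the adjacency of `i` and `j` in the right graph, as a function of the state of
all blocks. -/
noncomputable def rightSign (x : BlockIndex m n K → Bool × Bool) (i j : Fin n) : ℝ :=
  open Classical in
  if h : ∃ b : BlockIndex m n K, TouchesRight b i j then if (x h.choose).2 then 1 else -1 else 0

lemma leftSign_eq {b : BlockIndex m n K} {i j : Fin m} (h : TouchesLeft b i j)
    (x : BlockIndex m n K → Bool × Bool) : leftSign x i j = if (x b).1 then 1 else -1 := by
  have hex : ∃ b : BlockIndex m n K, TouchesLeft b i j := ⟨b, h⟩
  rw [leftSign, dif_pos hex, hex.choose_spec.unique h]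

lemma rightSign_eq {b : BlockIndex m n K} {i j : Fin n} (h : TouchesRight b i j)
    (x : BlockIndex m n K → Bool × Bool) : rightSign x i j = if (x b).2 then 1 else -1 := by
  have hex : ∃ b : BlockIndex m n K, TouchesRight b i j := ⟨b, h⟩
  rw [rightSign, dif_pos hex, hex.choose_spec.unique h]

lemma leftSign_self (x : BlockIndex m n K → Bool × Bool) (i : Fin m) : leftSign x i i = 0 :=
  dif_neg fun ⟨_, h⟩ => h.ne rfl

lemma rightSign_self (x : BlockIndex m n K → Bool × Bool) (i : Fin n) : rightSign x i i = 0 :=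
  dif_neg fun ⟨_, h⟩ => h.ne rfl

lemma abs_leftSign_le (x : BlockIndex m n K → Bool × Bool) (i j : Fin m) :
    |leftSign x i j| ≤ 1 := by
  rw [leftSign]; split_ifs <;> simp

lemma abs_rightSign_le (x : BlockIndex m n K → Bool × Bool) (i j : Fin n) :
    |rightSign x i j| ≤ 1 := by
  rw [rightSign]; split_ifs <;> simp

lemma leftSign_congr {b : BlockIndex m n K} {i j : Fin m} (h : ¬ TouchesLeft b i j)
    {x y : BlockIndex m n K → Bool × Bool} (hxy : ∀ c, c ≠ b → x c = y c) :
    leftSign x i j = leftSign y i j := by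
  by_cases hij : i = j
  · rw [hij, leftSign_self, leftSign_self]
  · obtain ⟨c, hc⟩ := exists_touchesLeft (n := n) (K := K) hij
    rw [leftSign_eq hc, leftSign_eq hc, hxy c fun e => h (e ▸ hc)]

lemma rightSign_congr {b : BlockIndex m n K} {i j : Fin n} (h : ¬ TouchesRight b i j)
    {x y : BlockIndex m n K → Bool × Bool} (hxy : ∀ c, c ≠ b → x c = y c) :
    rightSign x i j = rightSign y i j := by
  by_cases hij : i = j
  · rw [hij, rightSign_self, rightSign_self]
  · obtain ⟨c, hc⟩ := exists_touchesRight (m := m) (K := K) hij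
    rw [rightSign_eq hc, rightSign_eq hc, hxy c fun e => h (e ▸ hc)]

section Model

variable {Ω : Type*}

/-- The states of the two adjacencies of a block. -/
noncomputable def blockState (hm : K ≤ m) (hn : K ≤ n) (G : Ω → SimpleGraph (Fin m))
    (H : Ω → SimpleGraph (Fin n)) (b : BlockIndex m n K) (ω : Ω) : Bool × Bool :=
  open Classical in
  (decide ((block hm hn G H b ω).1 = 1), decide ((block hm hn G H b ω).2 = 1))

lemma adjInd_comm {k : ℕ} (G : Ω → SimpleGraph (Fin k)) (i j : Fin k) (ω : Ω) :
    adjInd G i j ω = adjInd G j i ω := by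
  classical exact if_congr ((G ω).adj_comm i j) rfl rfl

lemma signMatrix_eq_adjInd {k : ℕ} (G : Ω → SimpleGraph (Fin k)) {i j : Fin k} (hij : i ≠ j) (ω : Ω) :
    signMatrix (G ω) i j = 2 * adjInd G i j ω - 1 := by
  simp only [signMatrix, Matrix.of_apply, hij, if_false, adjInd]
  split_ifs <;> norm_num

lemma block_fst_of_touchesLeft (hm : K ≤ m) (hn : K ≤ n) (G : Ω → SimpleGraph (Fin m))
    (H : Ω → SimpleGraph (Fin n)) {b : BlockIndex m n K} {i j : Fin m} (h : TouchesLeft b i j)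
    (ω : Ω) : (block hm hn G H b ω).1 = adjInd G i j ω := by
  rcases b with e | e | e
  · rcases Sym2.eq_iff.1 h with ⟨h1, h2⟩ | ⟨h1, h2⟩
    · rw [show i = Fin.castLE hm e.1.1 from Fin.ext h1.symm,
        show j = Fin.castLE hm e.1.2 from Fin.ext h2.symm]; rfl
    · rw [show j = Fin.castLE hm e.1.1 from Fin.ext h1.symm,
        show i = Fin.castLE hm e.1.2 from Fin.ext h2.symm, adjInd_comm]; rfl
  · rcases Sym2.eq_iff.1 h with ⟨h1, h2⟩ | ⟨h1, h2⟩
    · rw [show i = e.1.1 from Fin.ext h1.symm, show j = e.1.2 from Fin.ext h2.symm]; rfl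
    · rw [show j = e.1.1 from Fin.ext h1.symm, show i = e.1.2 from Fin.ext h2.symm, adjInd_comm]; rfl
  · exact h.elim

lemma block_snd_of_touchesRight (hm : K ≤ m) (hn : K ≤ n) (G : Ω → SimpleGraph (Fin m))
    (H : Ω → SimpleGraph (Fin n)) {b : BlockIndex m n K} {i j : Fin n} (h : TouchesRight b i j)
    (ω : Ω) : (block hm hn G H b ω).2 = adjInd H i j ω := by
  rcases b with e | e | e
  · rcases Sym2.eq_iff.1 h with ⟨h1, h2⟩ | ⟨h1, h2⟩
    · rw [show i = Fin.castLE hn e.1.1 from Fin.ext h1.symm,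
        show j = Fin.castLE hn e.1.2 from Fin.ext h2.symm]; rfl
    · rw [show j = Fin.castLE hn e.1.1 from Fin.ext h1.symm,
        show i = Fin.castLE hn e.1.2 from Fin.ext h2.symm, adjInd_comm]; rfl
  · exact h.elim
  · rcases Sym2.eq_iff.1 h with ⟨h1, h2⟩ | ⟨h1, h2⟩
    · rw [show i = e.1.1 from Fin.ext h1.symm, show j = e.1.2 from Fin.ext h2.symm]; rfl
    · rw [show j = e.1.1 from Fin.ext h1.symm, show i = e.1.2 from Fin.ext h2.symm, adjInd_comm]; rfl

/-- This makes the overlaps deterministic functions of independent variables with finitely many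
values, the form required by the bounded differences inequality. -/
lemma leftSign_blockState (hm : K ≤ m) (hn : K ≤ n) (G : Ω → SimpleGraph (Fin m))
    (H : Ω → SimpleGraph (Fin n)) (i j : Fin m) (ω : Ω) :
    leftSign (fun b => blockState hm hn G H b ω) i j = signMatrix (G ω) i j := by
  by_cases hij : i = j
  · rw [hij, leftSign_self]; simp [signMatrix]
  · obtain ⟨b, hb⟩ := exists_touchesLeft (n := n) (K := K) hij
    rw [leftSign_eq hb, signMatrix_eq_adjInd G hij, blockState,
      block_fst_of_touchesLeft hm hn G H hb, adjInd]
    split_ifs <;> norm_num at *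

lemma rightSign_blockState (hm : K ≤ m) (hn : K ≤ n) (G : Ω → SimpleGraph (Fin m))
    (H : Ω → SimpleGraph (Fin n)) (i j : Fin n) (ω : Ω) :
    rightSign (fun b => blockState hm hn G H b ω) i j = signMatrix (H ω) i j := by
  by_cases hij : i = j
  · rw [hij, rightSign_self]; simp [signMatrix]
  · obtain ⟨b, hb⟩ := exists_touchesRight (m := m) (K := K) hij
    rw [rightSign_eq hb, signMatrix_eq_adjInd H hij, blockState,
      block_snd_of_touchesRight hm hn G H hb, adjInd]
    split_ifs <;> norm_num at *

variable [MeasurableSpace Ω] {μ : Measure Ω}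

lemma measurable_adjInd {k : ℕ} {G : Ω → SimpleGraph (Fin k)} {i j : Fin k}
    (h : MeasurableSet {ω | (G ω).Adj i j}) : Measurable (adjInd G i j) := by
  classical
  exact Measurable.ite h measurable_const measurable_const

lemma measurable_block (hm : K ≤ m) (hn : K ≤ n) {G : Ω → SimpleGraph (Fin m)}
    {H : Ω → SimpleGraph (Fin n)} (hG : ∀ i j, MeasurableSet {ω | (G ω).Adj i j})
    (hH : ∀ i j, MeasurableSet {ω | (H ω).Adj i j}) (b : BlockIndex m n K) :
    Measurable (block hm hn G H b) := by
  rcases b with e | e | e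
  · exact (measurable_adjInd (hG _ _)).prodMk (measurable_adjInd (hH _ _))
  · exact (measurable_adjInd (hG _ _)).prodMk measurable_const
  · exact measurable_const.prodMk (measurable_adjInd (hH _ _))

open Classical in
lemma measurable_decide_eq_one :
    Measurable fun z : ℝ × ℝ => (decide (z.1 = 1), decide (z.2 = 1)) := by
  refine Measurable.prodMk (measurable_to_bool ?_) (measurable_to_bool ?_)
  · convert measurable_fst (measurableSet_singleton (1 : ℝ)) using 1
    ext; simp
  · convert measurable_snd (measurableSet_singleton (1 : ℝ)) using 1
    ext; simp

end Model

end

/-! ### Means of products of signs. -/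

section

section Model

variable {Ω : Type*} [MeasurableSpace Ω] {μ : Measure Ω}

lemma adjInd_eq_indicator {Ω : Type*} {k : ℕ} (G : Ω → SimpleGraph (Fin k)) (i j : Fin k) :
    adjInd G i j = {ω | (G ω).Adj i j}.indicator 1 := by
  ext ω
  simp only [adjInd, Set.indicator, Set.mem_ofPred_eq, Pi.one_apply]

lemma memLp_adjInd [IsProbabilityMeasure μ] {k : ℕ} {G : Ω → SimpleGraph (Fin k)} {i j : Fin k}
    (h : MeasurableSet {ω | (G ω).Adj i j}) : MemLp (adjInd G i j) 2 μ := by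
  refine MemLp.of_bound (measurable_adjInd h).aestronglyMeasurable 1
    (Filter.Eventually.of_forall fun ω => ?_)
  simp only [adjInd]
  split_ifs <;> simp

lemma integral_adjInd {k : ℕ} {G : Ω → SimpleGraph (Fin k)} {i j : Fin k}
    (h : MeasurableSet {ω | (G ω).Adj i j}) :
    ∫ ω, adjInd G i j ω ∂μ = μ.real {ω | (G ω).Adj i j} := by
  rw [adjInd_eq_indicator, integral_indicator_one h]

lemma variance_adjInd [IsProbabilityMeasure μ] {k : ℕ} {G : Ω → SimpleGraph (Fin k)} {i j : Fin k}
    (h : MeasurableSet {ω | (G ω).Adj i j}) :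
    Var[adjInd G i j; μ] = μ.real {ω | (G ω).Adj i j} * (1 - μ.real {ω | (G ω).Adj i j}) := by
  have hsq : (adjInd G i j) ^ 2 = adjInd G i j := by
    ext ω
    simp only [Pi.pow_apply, adjInd]
    split_ifs <;> simp
  rw [variance_eq_sub (memLp_adjInd h), hsq, integral_adjInd h]
  ring

lemma measurable_signMatrix {k : ℕ} {G : Ω → SimpleGraph (Fin k)} {i j : Fin k}
    (h : MeasurableSet {ω | (G ω).Adj i j}) : Measurable fun ω => signMatrix (G ω) i j := by
  by_cases hij : i = j
  · simp [signMatrix, hij]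
  · simp only [signMatrix_eq_adjInd G hij]
    exact ((measurable_adjInd h).const_mul 2).sub_const 1

lemma abs_signMatrix_le {k : ℕ} (G : SimpleGraph (Fin k)) (i j : Fin k) : |signMatrix G i j| ≤ 1 := by
  simp only [signMatrix, Matrix.of_apply]
  split_ifs <;> simp

lemma signMatrix_comm {k : ℕ} (G : SimpleGraph (Fin k)) (i j : Fin k) :
    signMatrix G i j = signMatrix G j i := by
  simp only [signMatrix, Matrix.of_apply]
  classical exact if_congr eq_comm rfl (if_congr (G.adj_comm i j) rfl rfl)

lemma integral_signMatrix_mul [IsProbabilityMeasure μ] {k l : ℕ}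
    {G : Ω → SimpleGraph (Fin k)} {H : Ω → SimpleGraph (Fin l)}
    {i j : Fin k} {u v : Fin l} (hij : i ≠ j) (huv : u ≠ v)
    (hG : MeasurableSet {ω | (G ω).Adj i j}) (hH : MeasurableSet {ω | (H ω).Adj u v}) :
    ∫ ω, signMatrix (G ω) i j * signMatrix (H ω) u v ∂μ =
      4 * cov[adjInd G i j, adjInd H u v; μ] +
        (2 * μ.real {ω | (G ω).Adj i j} - 1) * (2 * μ.real {ω | (H ω).Adj u v} - 1) := by
  have hX := memLp_adjInd (μ := μ) hG
  have hY := memLp_adjInd (μ := μ) hH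
  have hXi : Integrable (adjInd G i j) μ := hX.integrable (by norm_num)
  have hYi : Integrable (adjInd H u v) μ := hY.integrable (by norm_num)
  have hXY : Integrable (fun ω => adjInd G i j ω * adjInd H u v ω) μ := hX.integrable_mul hY
  rw [covariance_eq_sub hX hY, integral_adjInd hG, integral_adjInd hH]
  have : ∀ ω, signMatrix (G ω) i j * signMatrix (H ω) u v =
      4 * (adjInd G i j ω * adjInd H u v ω) - 2 * adjInd G i j ω - 2 * adjInd H u v ω + 1 := by
    intro ω
    rw [signMatrix_eq_adjInd G hij, signMatrix_eq_adjInd H huv]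
    ring
  simp only [this]
  have i1 : Integrable (fun ω => 4 * (adjInd G i j ω * adjInd H u v ω)) μ := hXY.const_mul 4
  have i2 : Integrable (fun ω => 2 * adjInd G i j ω) μ := hXi.const_mul 2
  have i3 : Integrable (fun ω => 2 * adjInd H u v ω) μ := hYi.const_mul 2
  rw [integral_add ((i1.sub' i2).sub' i3) (integrable_const _), integral_sub (i1.sub' i2) i3,
    integral_sub i1 i2, integral_const_mul, integral_const_mul, integral_const_mul,
    integral_adjInd hG, integral_adjInd hH]
  simp only [integral_const, probReal_univ, smul_eq_mul, Pi.mul_apply]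
  ring

variable {m n K : ℕ} {p ρ : ℕ → ℕ → ℝ} {G : Ω → SimpleGraph (Fin m)} {H : Ω → SimpleGraph (Fin n)}

lemma IsCorrelatedBernoulli.prob_mem_left (h : IsCorrelatedBernoulli μ m n K p ρ G H) {q : ℝ}
    (hp : ∀ i j, i < j → j < max m n → p i j ∈ Set.Icc q (1 - q)) {i j : Fin m} (hij : i ≠ j) :
    μ.real {ω | (G ω).Adj i j} ∈ Set.Icc q (1 - q) := by
  wlog hlt : i < j generalizing i j
  · simpa only [SimpleGraph.adj_comm] using
      this hij.symm (lt_of_le_of_ne (not_lt.1 hlt) hij.symm)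
  rw [h.prob_left i j hlt]
  exact hp i j hlt (by omega)

lemma IsCorrelatedBernoulli.prob_mem_right (h : IsCorrelatedBernoulli μ m n K p ρ G H) {q : ℝ}
    (hp : ∀ i j, i < j → j < max m n → p i j ∈ Set.Icc q (1 - q)) {i j : Fin n} (hij : i ≠ j) :
    μ.real {ω | (H ω).Adj i j} ∈ Set.Icc q (1 - q) := by
  wlog hlt : i < j generalizing i j
  · simpa only [SimpleGraph.adj_comm] using
      this hij.symm (lt_of_le_of_ne (not_lt.1 hlt) hij.symm)
  rw [h.prob_right i j hlt]
  exact hp i j hlt (by omega)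

/-- The adjacencies of two pairs that do not correspond to each other are uncorrelated enough. -/
lemma IsCorrelatedBernoulli.integral_le_of_ne [IsProbabilityMeasure μ]
    (h : IsCorrelatedBernoulli μ m n K p ρ G H) {q : ℝ}
    (hp : ∀ i j, i < j → j < max m n → p i j ∈ Set.Icc q (1 - q))
    {i j : Fin m} {u v : Fin n}
    (hne : ¬ ((i : ℕ) < K ∧ (j : ℕ) < K ∧ s((i : ℕ), (j : ℕ)) = s((u : ℕ), (v : ℕ)))) :
    ∫ ω, signMatrix (G ω) i j * signMatrix (H ω) u v ∂μ ≤ (1 - 2 * q) ^ 2 := by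
  by_cases hij : i = j
  · simp only [hij, signMatrix, Matrix.of_apply, if_true, zero_mul, integral_zero]
    positivity
  by_cases huv : u = v
  · simp only [huv, signMatrix, Matrix.of_apply, if_true, mul_zero, integral_zero]
    positivity
  obtain ⟨b, hb⟩ := exists_touchesLeft (n := n) (K := K) hij
  obtain ⟨b', hb'⟩ := exists_touchesRight (m := m) (K := K) huv
  -- A common block would be a core block, and the two pairs would coincide inside the core.
  have hbb : b ≠ b' := by
    rintro rfl
    have := hb.lt_of_touchesRight hb'
    exact hne ⟨this.1, this.2, hb.pair_eq.symm.trans hb'.pair_eq⟩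
  have hind := (h.independent.indepFun hbb).comp measurable_fst measurable_snd
  have h1 : Prod.fst ∘ block h.core_le_left h.core_le_right G H b = adjInd G i j :=
    funext fun ω => block_fst_of_touchesLeft _ _ G H hb ω
  have h2 : Prod.snd ∘ block h.core_le_left h.core_le_right G H b' = adjInd H u v :=
    funext fun ω => block_snd_of_touchesRight _ _ G H hb' ω
  rw [h1, h2] at hind
  rw [integral_signMatrix_mul hij huv (h.measurable_left i j) (h.measurable_right u v),
    hind.covariance_eq_zero (memLp_adjInd (h.measurable_left i j))
      (memLp_adjInd (h.measurable_right u v))]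
  obtain ⟨ha, hb⟩ := h.prob_mem_left hp hij
  obtain ⟨hc, hd⟩ := h.prob_mem_right hp huv
  generalize μ.real {ω | (G ω).Adj i j} = x at *
  generalize μ.real {ω | (H ω).Adj u v} = y at *
  -- (1-2q)² - (2x-1)(2y-1) is twice the sum of these two products.
  nlinarith [mul_nonneg (sub_nonneg.2 ha) (sub_nonneg.2 hd),
    mul_nonneg (sub_nonneg.2 hb) (sub_nonneg.2 hc)]

/-- The mean is 4p(1-p)ρ + (2p-1)², a weighted average of ρ and 1, hence at least ρ. -/
lemma IsCorrelatedBernoulli.le_integral_core [IsProbabilityMeasure μ]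
    (h : IsCorrelatedBernoulli μ m n K p ρ G H) {q : ℝ}
    (hq : 0 < q) (hp : ∀ i j, i < j → j < max m n → p i j ∈ Set.Icc q (1 - q))
    {i j : Fin K} (hij : i < j) :
    ρ i j ≤ ∫ ω, signMatrix (G ω) (Fin.castLE h.core_le_left i) (Fin.castLE h.core_le_left j) *
      signMatrix (H ω) (Fin.castLE h.core_le_right i) (Fin.castLE h.core_le_right j) ∂μ := by
  have hl : Fin.castLE h.core_le_left i < Fin.castLE h.core_le_left j := hij
  have hr : Fin.castLE h.core_le_right i < Fin.castLE h.core_le_right j := hij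
  have hc := h.correlation i j hij
  have hρ := h.ρ_mem i j hij j.2
  have hpm := hp i j hij (by have := h.core_le_left; omega)
  rw [pearson, variance_adjInd (h.measurable_left _ _), variance_adjInd (h.measurable_right _ _),
    h.prob_left _ _ hl, h.prob_right _ _ hr] at hc
  rw [integral_signMatrix_mul hl.ne hr.ne (h.measurable_left _ _) (h.measurable_right _ _),
    h.prob_left _ _ hl, h.prob_right _ _ hr]
  simp only [Fin.val_castLE] at hc ⊢
  have hpos : 0 < p i j * (1 - p i j) := mul_pos (by linarith [hpm.1]) (by linarith [hpm.2])
  rw [Real.mul_self_sqrt hpos.le, div_eq_iff hpos.ne'] at hc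
  rw [hc]
  nlinarith [mul_nonneg (sub_nonneg.2 hρ.2) (sq_nonneg (2 * p i j - 1))]

lemma margin_le {q : ℝ} {K : ℕ} {ρ : ℕ → ℕ → ℝ} (hρ : ∀ i j, i < j → j < K → (1 - 2 * q) ^ 2 < ρ i j)
    {i j : ℕ} (hij : i < j) (hj : j < K) : (1 - 2 * q) ^ 2 + margin q K ρ ≤ ρ i j := by
  have : margin q K ρ ≤ ρ i j - (1 - 2 * q) ^ 2 := by
    refine csInf_le ⟨0, ?_⟩ ⟨i, j, hij, hj, rfl⟩
    rintro x ⟨i, j, hij, hj, rfl⟩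
    exact sub_nonneg.2 (hρ i j hij hj).le
  linarith

lemma margin_nonneg {q : ℝ} {K : ℕ} {ρ : ℕ → ℕ → ℝ}
    (hρ : ∀ i j, i < j → j < K → (1 - 2 * q) ^ 2 < ρ i j) : 0 ≤ margin q K ρ := by
  refine Real.sInf_nonneg ?_
  rintro x ⟨i, j, hij, hj, rfl⟩
  exact sub_nonneg.2 (hρ i j hij hj).le

lemma margin_eq_zero {q : ℝ} {K : ℕ} {ρ : ℕ → ℕ → ℝ} (hK : K ≤ 1) : margin q K ρ = 0 := by
  have : {x | ∃ i j, i < j ∧ j < K ∧ x = ρ i j - (1 - 2 * q) ^ 2} = ∅ := by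
    ext x
    simp only [Set.mem_ofPred_eq, Set.mem_empty_iff_false, iff_false]
    rintro ⟨i, j, hij, hj, -⟩
    omega
  rw [margin, this, Real.sInf_empty]

/-- Corresponding core adjacencies are strongly correlated. -/
lemma IsCorrelatedBernoulli.le_integral_of_eq [IsProbabilityMeasure μ]
    (h : IsCorrelatedBernoulli μ m n K p ρ G H) {q : ℝ}
    (hq : 0 < q) (hp : ∀ i j, i < j → j < max m n → p i j ∈ Set.Icc q (1 - q))
    (hρ : ∀ i j, i < j → j < K → (1 - 2 * q) ^ 2 < ρ i j)
    {i j : Fin m} {u v : Fin n} (hij : i ≠ j) (hi : (i : ℕ) < K) (hj : (j : ℕ) < K)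
    (hu : (i : ℕ) = u) (hv : (j : ℕ) = v) :
    (1 - 2 * q) ^ 2 + margin q K ρ ≤ ∫ ω, signMatrix (G ω) i j * signMatrix (H ω) u v ∂μ := by
  wlog hlt : i < j generalizing i j u v
  · simpa only [signMatrix_comm] using
      this hij.symm hj hi hv hu (lt_of_le_of_ne (not_lt.1 hlt) hij.symm)
  refine (margin_le hρ hlt hj).trans ?_
  have := h.le_integral_core hq hp (i := ⟨i, hi⟩) (j := ⟨j, hj⟩) hlt
  have e1 : u = Fin.castLE h.core_le_right ⟨i, hi⟩ := Fin.ext hu.symm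
  have e2 : v = Fin.castLE h.core_le_right ⟨j, hj⟩ := Fin.ext hv.symm
  rw [e1, e2]
  exact this

end Model

end

/-! ### Matchings and counting of terms. -/

section

variable {m n K : ℕ}

/-- The set of positions of a partial permutation matrix with `K` ones. -/
structure IsMatching (K : ℕ) (P : Finset (Fin m × Fin n)) : Prop where
  card_eq : P.card = K
  injOn_fst : Set.InjOn Prod.fst (P : Set (Fin m × Fin n))
  injOn_snd : Set.InjOn Prod.snd (P : Set (Fin m × Fin n))

/-- The positions of the ones of `coreMatrix m n K`. -/
def corePairs (m n K : ℕ) : Finset (Fin m × Fin n) :=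
  Finset.univ.filter fun s => (s.1 : ℕ) = s.2 ∧ (s.1 : ℕ) < K

lemma mem_corePairs {s : Fin m × Fin n} :
    s ∈ corePairs m n K ↔ (s.1 : ℕ) = s.2 ∧ (s.1 : ℕ) < K := by
  simp [corePairs]

lemma isMatching_corePairs (hm : K ≤ m) (hn : K ≤ n) : IsMatching K (corePairs m n K) where
  card_eq := by
    have : corePairs m n K =
        Finset.univ.image fun i : Fin K => (Fin.castLE hm i, Fin.castLE hn i) := by
      ext ⟨a, b⟩
      simp only [mem_corePairs, Finset.mem_image, Finset.mem_univ, true_and, Prod.mk.injEq,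
        Fin.ext_iff, Fin.val_castLE]
      exact ⟨fun h => ⟨⟨a, h.2⟩, rfl, h.1⟩, fun ⟨i, h1, h2⟩ => ⟨by omega, by omega⟩⟩
    rw [this, Finset.card_image_of_injective, Finset.card_univ, Fintype.card_fin]
    intro i j hij
    simpa [Fin.ext_iff] using hij
  injOn_fst := by
    intro s hs t ht hst
    rw [Finset.mem_coe, mem_corePairs] at hs ht
    exact Prod.ext hst (Fin.ext (by rw [← hs.1, ← ht.1, hst]))
  injOn_snd := by
    intro s hs t ht hst
    rw [Finset.mem_coe, mem_corePairs] at hs ht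
    exact Prod.ext (Fin.ext (by rw [hs.1, ht.1, hst])) hst

open Classical in
lemma card_filter_sym2_le {α : Type*} (T : Finset α) (f g : α → ℕ) (z : Sym2 ℕ)
    (hinj : Set.InjOn (fun a => (f a, g a)) (T : Set α)) :
    (T.filter fun a => z = s(f a, g a)).card ≤ 2 := by
  induction z using Sym2.ind with
  | _ u v =>
  calc _ ≤ ({(u, v), (v, u)} : Finset (ℕ × ℕ)).card := by
        refine Finset.card_le_card_of_injOn (fun a => (f a, g a)) (fun a ha => ?_)
          (hinj.mono (Finset.coe_subset.2 (Finset.filter_subset _ _)))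
        have h := (Finset.mem_filter.1 ha).2
        simp only [Sym2.eq_iff] at h
        simp only [Finset.coe_insert, Finset.coe_singleton, Set.mem_insert_iff,
          Set.mem_singleton_iff, Prod.mk.injEq]
        tauto
    _ ≤ 2 := Finset.card_le_two

/-- The term of a pair of positions depends on the block `b`. -/
def Touches (b : BlockIndex m n K) (τ : (Fin m × Fin n) × (Fin m × Fin n)) : Prop :=
  TouchesLeft b τ.1.1 τ.2.1 ∨ TouchesRight b τ.1.2 τ.2.2

-- In a matching a position is determined by either of its coordinates. So the pair of vertices of a
-- block, read in either direction, accounts for at most two terms through G and two through H.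
open Classical in
lemma card_filter_touches_le {P Q : Finset (Fin m × Fin n)} {L : ℕ} (hP : IsMatching L P)
    (hQ : IsMatching L Q) (b : BlockIndex m n K) :
    ((P ×ˢ Q).filter fun τ => Touches b τ).card ≤ 4 := by
  have h1 := card_filter_sym2_le (P ×ˢ Q) (fun τ => (τ.1.1 : ℕ)) (fun τ => (τ.2.1 : ℕ))
    (blockPair b) (by
      rintro ⟨s, t⟩ h ⟨s', t'⟩ h' e
      simp only [Finset.mem_coe, Finset.mem_product, Prod.mk.injEq, Fin.val_inj] at h h' e
      exact Prod.ext (hP.injOn_fst h.1 h'.1 e.1) (hQ.injOn_fst h.2 h'.2 e.2))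
  have h2 := card_filter_sym2_le (P ×ˢ Q) (fun τ => (τ.1.2 : ℕ)) (fun τ => (τ.2.2 : ℕ))
    (blockPair b) (by
      rintro ⟨s, t⟩ h ⟨s', t'⟩ h' e
      simp only [Finset.mem_coe, Finset.mem_product, Prod.mk.injEq, Fin.val_inj] at h h' e
      exact Prod.ext (hP.injOn_snd h.1 h'.1 e.1) (hQ.injOn_snd h.2 h'.2 e.2))
  calc _ ≤ _ := Finset.card_le_card (t := ((P ×ˢ Q).filter fun τ =>
        blockPair b = s((τ.1.1 : ℕ), (τ.2.1 : ℕ))) ∪ (P ×ˢ Q).filter fun τ =>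
        blockPair b = s((τ.1.2 : ℕ), (τ.2.2 : ℕ))) (by
          intro τ hτ
          rw [Finset.mem_filter] at hτ
          rw [Finset.mem_union, Finset.mem_filter, Finset.mem_filter]
          exact hτ.2.imp (fun h => ⟨hτ.1, h.pair_eq⟩) fun h => ⟨hτ.1, h.pair_eq⟩)
    _ ≤ 2 + 2 := (Finset.card_union_le _ _).trans (Nat.add_le_add h1 h2)

open Classical in
lemma card_touches_le (τ : (Fin m × Fin n) × (Fin m × Fin n)) :
    (Finset.univ.filter fun b : BlockIndex m n K => Touches b τ).card ≤ 2 := by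
  calc _ ≤ ((Finset.univ.filter fun b : BlockIndex m n K => TouchesLeft b τ.1.1 τ.2.1) ∪
        Finset.univ.filter fun b : BlockIndex m n K => TouchesRight b τ.1.2 τ.2.2).card :=
        Finset.card_le_card fun b hb => by
          rw [Finset.mem_filter] at hb
          simpa [Touches] using hb.2
    _ ≤ 1 + 1 := by
        refine (Finset.card_union_le _ _).trans (Nat.add_le_add ?_ ?_)
        · refine Finset.card_le_one.2 fun a ha b hb => ?_
          exact (Finset.mem_filter.1 ha).2.unique (Finset.mem_filter.1 hb).2
        · refine Finset.card_le_one.2 fun a ha b hb => ?_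
          exact (Finset.mem_filter.1 ha).2.unique (Finset.mem_filter.1 hb).2

/-- The number of terms in which two products of finite sets of equal size differ. -/
lemma card_product_sdiff {α : Type*} [DecidableEq α] {C P Q : Finset α} {K : ℕ} (hC : C.card = K)
    (hP : P.card = K) (hQ : Q.card = K) :
    ((P ×ˢ Q) \ (C ×ˢ C)).card = ((C ×ˢ C) \ (P ×ˢ Q)).card ∧
      K * ((C \ P).card + (C \ Q).card) ≤ 2 * ((C ×ˢ C) \ (P ×ˢ Q)).card ∧
      ((C ×ˢ C) \ (P ×ˢ Q)).card ≤ K * ((C \ P).card + (C \ Q).card) := by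
  have e1 : ((P ×ˢ Q) \ (C ×ˢ C)).card = ((C ×ˢ C) \ (P ×ˢ Q)).card :=
    Finset.card_sdiff_comm (by simp [hC, hP, hQ])
  have e2 := Finset.card_sdiff_add_card_inter (C ×ˢ C) (P ×ˢ Q)
  rw [Finset.product_inter_product, Finset.card_product, Finset.card_product, hC] at e2
  have e3 := Finset.card_sdiff_add_card_inter C P
  have e4 := Finset.card_sdiff_add_card_inter C Q
  rw [hC] at e3 e4
  -- With a = |C \ P| and b = |C \ Q|, the size is K² - (K-a)(K-b) = K(a+b) - ab, and 0 ≤ 2ab ≤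
  -- K(a+b) because a, b ≤ K.
  refine ⟨e1, ?_, ?_⟩ <;> nlinarith

/-- The sum of the products `A i i' * B j j'` over the pairs of positions in `P ×ˢ Q`. -/
def overlap (A : Matrix (Fin m) (Fin m) ℝ) (B : Matrix (Fin n) (Fin n) ℝ)
    (P Q : Finset (Fin m × Fin n)) : ℝ :=
  ∑ τ ∈ P ×ˢ Q, A τ.1.1 τ.2.1 * B τ.1.2 τ.2.2

/-! ### Tail bound for one pair of matchings. -/

section Estimate

variable {Ω : Type*} [MeasurableSpace Ω] {μ : Measure Ω}
  {p ρ : ℕ → ℕ → ℝ} {G : Ω → SimpleGraph (Fin m)} {H : Ω → SimpleGraph (Fin n)}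

/-- A diagonal term is a single position of C missing from P or from Q. These terms vanish
identically and so lack the gain of the core, hence they must be few. -/
lemma card_diagonal_sdiff_le {α : Type*} [DecidableEq α] (C P Q : Finset α) :
    (((C ×ˢ C) \ (P ×ˢ Q)).filter fun τ => τ.1 = τ.2).card ≤ (C \ P).card + (C \ Q).card := by
  refine le_trans ?_ (Finset.card_union_le _ _)
  refine Finset.card_le_card_of_injOn Prod.fst ?_ ?_
  · rintro ⟨s, t⟩ h
    simp only [Finset.coe_filter, Finset.mem_sdiff, Finset.mem_product, Set.mem_ofPred_eq,
      not_and_or] at h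
    obtain ⟨⟨hC, h⟩, rfl⟩ := h
    simp only [Finset.coe_union, Finset.coe_sdiff, Set.mem_union, Set.mem_sdiff, Finset.mem_coe]
    exact h.imp (fun h => ⟨hC.1, h⟩) fun h => ⟨hC.1, h⟩
  · rintro ⟨s, t⟩ h ⟨s', t'⟩ h' e
    simp only [Finset.coe_filter, Set.mem_ofPred_eq] at h h' e
    rw [Prod.mk.injEq]
    exact ⟨e, by rw [← h.2, ← h'.2, e]⟩

/-- A pair of positions outside of the core whose term is the product of corresponding adjacencies,
read in opposite directions. -/
def IsSwapped (K : ℕ) (τ : (Fin m × Fin n) × (Fin m × Fin n)) : Prop :=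
  τ.1 ∉ corePairs m n K ∧ (τ.2.1 : ℕ) = τ.1.2 ∧ (τ.2.2 : ℕ) = τ.1.1

-- The first position determines the second by reversal. Swapped terms may be as strongly correlated
-- as core terms, hence they too must be few.
open Classical in
lemma card_isSwapped_le (P Q : Finset (Fin m × Fin n)) (U : Finset _) :
    (((P ×ˢ Q) \ U).filter fun τ => IsSwapped K τ).card ≤ (P \ corePairs m n K).card := by
  refine Finset.card_le_card_of_injOn Prod.fst ?_ ?_
  · intro τ h
    simp only [Finset.coe_filter, Finset.mem_sdiff, Finset.mem_product, Set.mem_ofPred_eq] at h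
    exact Finset.mem_coe.2 (Finset.mem_sdiff.2 ⟨h.1.1.1, h.2.1⟩)
  · rintro ⟨s, t⟩ h ⟨s', t'⟩ h' e
    obtain ⟨-, h1, h2⟩ := (Finset.mem_filter.1 h).2
    obtain ⟨-, h1', h2'⟩ := (Finset.mem_filter.1 h').2
    simp only at h1 h2 h1' h2' e
    rw [Prod.mk.injEq]
    exact ⟨e, Prod.ext (Fin.ext (by rw [h1, h1', e])) (Fin.ext (by rw [h2, h2', e]))⟩

lemma integrable_term [IsProbabilityMeasure μ] (h : IsCorrelatedBernoulli μ m n K p ρ G H)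
    (τ : (Fin m × Fin n) × (Fin m × Fin n)) :
    Integrable (fun ω => signMatrix (G ω) τ.1.1 τ.2.1 * signMatrix (H ω) τ.1.2 τ.2.2) μ := by
  refine Integrable.of_bound ((measurable_signMatrix (h.measurable_left _ _)).mul
    (measurable_signMatrix (h.measurable_right _ _))).aestronglyMeasurable 1
    (Filter.Eventually.of_forall fun ω => ?_)
  rw [Real.norm_eq_abs, abs_mul]
  exact mul_le_one₀ (abs_signMatrix_le _ _ _) (abs_nonneg _) (abs_signMatrix_le _ _ _)

/-- The expected overlap of the core with itself exceeds that of any two other matchings. -/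
lemma le_integral_overlap_sub [IsProbabilityMeasure μ]
    (h : IsCorrelatedBernoulli μ m n K p ρ G H) {q : ℝ}
    (hq : 0 < q) (hp : ∀ i j, i < j → j < max m n → p i j ∈ Set.Icc q (1 - q))
    (hρ : ∀ i j, i < j → j < K → (1 - 2 * q) ^ 2 < ρ i j) (hK : 2 ≤ K)
    {P Q : Finset (Fin m × Fin n)} (hP : IsMatching K P) (hQ : IsMatching K Q)
    (hε : 8 ≤ K * margin q K ρ) :
    (((corePairs m n K \ P).card + (corePairs m n K \ Q).card : ℕ) : ℝ) * (K * margin q K ρ) / 4 ≤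
      ∫ ω, (overlap (signMatrix (G ω)) (signMatrix (H ω)) (corePairs m n K) (corePairs m n K) -
        overlap (signMatrix (G ω)) (signMatrix (H ω)) P Q) ∂μ := by
  classical
  set C := corePairs m n K with hC
  have hCm : IsMatching K C := isMatching_corePairs h.core_le_left h.core_le_right
  set ε := margin q K ρ
  set c := (1 - 2 * q) ^ 2
  set E : (Fin m × Fin n) × (Fin m × Fin n) → ℝ := fun τ =>
    ∫ ω, signMatrix (G ω) τ.1.1 τ.2.1 * signMatrix (H ω) τ.1.2 τ.2.2 ∂μ with hE
  have hcε : c + ε ≤ 1 :=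
    (margin_le hρ zero_lt_one hK).trans (h.ρ_mem 0 1 zero_lt_one hK).2
  have hc0 : 0 ≤ c := sq_nonneg _
  have hε0 : 0 ≤ ε := margin_nonneg hρ
  have hEle : ∀ τ, E τ ≤ 1 := by
    intro τ
    calc E τ ≤ ∫ _, (1 : ℝ) ∂μ := by
          refine integral_mono (integrable_term h τ) (integrable_const _) fun ω => ?_
          refine (le_abs_self _).trans ?_
          rw [abs_mul]
          exact mul_le_one₀ (abs_signMatrix_le _ _ _) (abs_nonneg _) (abs_signMatrix_le _ _ _)
      _ = 1 := by simp
  have hint : ∫ ω, (overlap (signMatrix (G ω)) (signMatrix (H ω)) C C -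
        overlap (signMatrix (G ω)) (signMatrix (H ω)) P Q) ∂μ =
      ∑ τ ∈ (C ×ˢ C) \ (P ×ˢ Q), E τ - ∑ τ ∈ (P ×ˢ Q) \ (C ×ˢ C), E τ := by
    simp only [overlap]
    rw [integral_sub (integrable_finsetSum _ fun τ _ => integrable_term h τ)
      (integrable_finsetSum _ fun τ _ => integrable_term h τ),
      integral_finsetSum _ fun τ _ => integrable_term h τ,
      integral_finsetSum _ fun τ _ => integrable_term h τ, Finset.sum_sdiff_sub_sum_sdiff]
  obtain ⟨hM1, hM2, -⟩ := card_product_sdiff hCm.card_eq hP.card_eq hQ.card_eq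
  have hlow : ∑ τ ∈ (C ×ˢ C) \ (P ×ˢ Q), ((c + ε) - if τ.1 = τ.2 then 1 else 0) ≤
      ∑ τ ∈ (C ×ˢ C) \ (P ×ˢ Q), E τ := by
    refine Finset.sum_le_sum fun τ hτ => ?_
    obtain ⟨h1, h2⟩ := Finset.mem_product.1 (Finset.mem_sdiff.1 hτ).1
    rw [hC, mem_corePairs] at h1 h2
    split_ifs with hd
    · have : E τ = 0 := by simp [hE, hd, signMatrix]
      linarith
    · rw [sub_zero]
      refine h.le_integral_of_eq hq hp hρ (fun e => hd ?_) h1.2 h2.2 h1.1 h2.1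
      exact hCm.injOn_fst (by rw [hC, Finset.mem_coe, mem_corePairs]; exact h1)
        (by rw [hC, Finset.mem_coe, mem_corePairs]; exact h2) e
  have hupp : ∑ τ ∈ (P ×ˢ Q) \ (C ×ˢ C), E τ ≤
      ∑ τ ∈ (P ×ˢ Q) \ (C ×ˢ C), (c + if IsSwapped K τ then 1 else 0) := by
    refine Finset.sum_le_sum fun τ hτ => ?_
    split_ifs with hs
    · linarith [hEle τ]
    · rw [add_zero]
      refine h.integral_le_of_ne hp ?_
      -- Agreement in the same direction puts both positions in C. Agreement in opposite directions
      -- is a swap, unless the first position lies in C, and then again both do.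
      rintro ⟨h1, h2, h3⟩
      have hτ' := (Finset.mem_sdiff.1 hτ).2
      rw [Finset.mem_product, hC, mem_corePairs, mem_corePairs] at hτ'
      simp only [IsSwapped, mem_corePairs] at hs
      rw [Sym2.eq_iff] at h3
      omega
  have hd := card_diagonal_sdiff_le C P Q
  have hs := card_isSwapped_le (K := K) P Q (C ×ˢ C)
  rw [← hC, Finset.card_sdiff_comm (hP.card_eq.trans hCm.card_eq.symm)] at hs
  simp only [Finset.sum_sub_distrib, Finset.sum_add_distrib, Finset.sum_const, nsmul_eq_mul,
    Finset.sum_boole] at hlow hupp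
  rw [hM1] at hupp
  rw [hint]
  have hd' : ((((C ×ˢ C) \ (P ×ˢ Q)).filter fun τ => τ.1 = τ.2).card : ℝ) ≤
    ((C \ P).card + (C \ Q).card : ℕ) := by exact_mod_cast hd
  have hs' : ((((P ×ˢ Q) \ (C ×ˢ C)).filter fun τ => IsSwapped K τ).card : ℝ) ≤
    ((C \ P).card + (C \ Q).card : ℕ) := by exact_mod_cast hs.trans (Nat.le_add_right _ _)
  have hM2' : (K : ℝ) * ((C \ P).card + (C \ Q).card : ℕ) ≤ 2 * ((C ×ˢ C) \ (P ×ˢ Q)).card := by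
    exact_mod_cast hM2
  have h0 : (0 : ℝ) ≤ ((C \ P).card + (C \ Q).card : ℕ) := Nat.cast_nonneg _
  generalize (((C \ P).card + (C \ Q).card : ℕ) : ℝ) = k at *
  generalize (((C ×ˢ C) \ (P ×ˢ Q)).card : ℝ) = M at *
  -- The mean is at least M(c+ε) - k - (Mc + k) = Mε - 2k. Here Mε ≥ kKε/2, and 2k ≤ kKε/4 since Kε
  -- ≥ 8.
  nlinarith [mul_le_mul_of_nonneg_right hM2' hε0, mul_le_mul_of_nonneg_left hε h0]

lemma measurable_blockState (h : IsCorrelatedBernoulli μ m n K p ρ G H) (b : BlockIndex m n K) :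
    Measurable (blockState h.core_le_left h.core_le_right G H b) :=
  measurable_decide_eq_one.comp
    (measurable_block h.core_le_left h.core_le_right h.measurable_left h.measurable_right b)

lemma iIndepFun_blockState (h : IsCorrelatedBernoulli μ m n K p ρ G H) :
    iIndepFun (blockState h.core_le_left h.core_le_right G H) μ :=
  h.independent.comp (fun _ => _) fun _ => measurable_decide_eq_one

/-- Two matchings are unlikely to have an overlap as large as that of the core. -/
theorem measure_overlap_le [IsProbabilityMeasure μ]
    (h : IsCorrelatedBernoulli μ m n K p ρ G H) {q : ℝ}
    (hq : 0 < q) (hp : ∀ i j, i < j → j < max m n → p i j ∈ Set.Icc q (1 - q))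
    (hρ : ∀ i j, i < j → j < K → (1 - 2 * q) ^ 2 < ρ i j) (hK : 2 ≤ K)
    {P Q : Finset (Fin m × Fin n)} (hP : IsMatching K P) (hQ : IsMatching K Q)
    (hε : 8 ≤ K * margin q K ρ) :
    μ.real {ω | overlap (signMatrix (G ω)) (signMatrix (H ω)) (corePairs m n K) (corePairs m n K) ≤
        overlap (signMatrix (G ω)) (signMatrix (H ω)) P Q} ≤
      Real.exp (-(((corePairs m n K \ P).card + (corePairs m n K \ Q).card : ℕ) *
        (margin q K ρ ^ 2 * K) / 1024)) := by
  classical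
  have hmean := le_integral_overlap_sub h hq hp hρ hK hP hQ hε
  set C := corePairs m n K with hC
  have hCm : IsMatching K C := isMatching_corePairs h.core_le_left h.core_le_right
  obtain ⟨hM1, hM2, hM3⟩ := card_product_sdiff hCm.card_eq hP.card_eq hQ.card_eq
  set T := ((C ×ˢ C) \ (P ×ˢ Q)) ∪ ((P ×ˢ Q) \ (C ×ˢ C)) with hT
  have hdisj : Disjoint ((C ×ˢ C) \ (P ×ˢ Q)) ((P ×ˢ Q) \ (C ×ˢ C)) := disjoint_sdiff_sdiff
  let φ (τ : (Fin m × Fin n) × (Fin m × Fin n)) (x : BlockIndex m n K → Bool × Bool) : ℝ :=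
    (if τ ∈ C ×ˢ C then 1 else -1) * (leftSign x τ.1.1 τ.2.1 * rightSign x τ.1.2 τ.2.2)
  have hsum : ∀ ω, ∑ τ ∈ T, φ τ (fun b => blockState h.core_le_left h.core_le_right G H b ω) =
      overlap (signMatrix (G ω)) (signMatrix (H ω)) C C -
        overlap (signMatrix (G ω)) (signMatrix (H ω)) P Q := by
    intro ω
    simp only [φ, leftSign_blockState, rightSign_blockState, overlap]
    rw [hT, Finset.sum_union hdisj, ← Finset.sum_sdiff_sub_sum_sdiff, sub_eq_add_neg,
      ← Finset.sum_neg_distrib]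
    congr 1
    · refine Finset.sum_congr rfl fun τ hτ => ?_
      rw [if_pos (Finset.mem_sdiff.1 hτ).1, one_mul]
    · refine Finset.sum_congr rfl fun τ hτ => ?_
      rw [if_neg (Finset.mem_sdiff.1 hτ).2, neg_one_mul]
  have hε0 : 0 ≤ margin q K ρ := margin_nonneg hρ
  have key := measure_sum_nonpos_le (iIndepFun_blockState h) (measurable_blockState h) T φ
    (fun τ x => by
      have h1 : |(if τ ∈ C ×ˢ C then (1 : ℝ) else -1)| = 1 := by split_ifs <;> simp
      rw [abs_mul, h1, one_mul, abs_mul]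
      exact mul_le_one₀ (abs_leftSign_le _ _ _) (abs_nonneg _) (abs_rightSign_le _ _ _))
    Touches
    (fun b τ x y hb hxy => by
      rw [Touches, not_or] at hb
      simp only [φ, leftSign_congr hb.1 hxy, rightSign_congr hb.2 hxy])
    -- Four terms for each of the two products C × C and P × Q.
    (fun τ _ => card_touches_le τ) 8
    (fun b => by
      calc _ ≤ _ := Finset.card_le_card (Finset.filter_subset_filter _
            (Finset.union_subset_union Finset.sdiff_subset Finset.sdiff_subset))
        _ ≤ 4 + 4 := by
          rw [Finset.filter_union]
          exact (Finset.card_union_le _ _).trans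
            (Nat.add_le_add (card_filter_touches_le hCm hCm b) (card_filter_touches_le hP hQ b)))
    (by
      simp only [hsum]
      exact le_trans (by positivity) hmean)
  simp only [hsum, sub_nonpos] at key
  refine key.trans (Real.exp_le_exp.2 ?_)
  have hTcard : (T.card : ℝ) = 2 * ((C ×ˢ C) \ (P ×ˢ Q)).card := by
    rw [hT, Finset.card_union_of_disjoint hdisj, hM1]
    push_cast; ring
  rw [hTcard, neg_div]
  refine neg_le_neg ?_
  have hM2' : (K : ℝ) * ((C \ P).card + (C \ Q).card : ℕ) ≤ 2 * ((C ×ˢ C) \ (P ×ˢ Q)).card := by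
    exact_mod_cast hM2
  have hM3' : (((C ×ˢ C) \ (P ×ˢ Q)).card : ℝ) ≤ K * ((C \ P).card + (C \ Q).card : ℕ) := by
    exact_mod_cast hM3
  have h0 : (0 : ℝ) ≤ ((C \ P).card + (C \ Q).card : ℕ) := Nat.cast_nonneg _
  have hM0 : (0 : ℝ) ≤ ((C ×ˢ C) \ (P ×ˢ Q)).card := Nat.cast_nonneg _
  have hK0 : (0 : ℝ) < K := by exact_mod_cast (by omega : 0 < K)
  generalize (((C \ P).card + (C \ Q).card : ℕ) : ℝ) = k at *
  generalize (((C ×ˢ C) \ (P ×ˢ Q)).card : ℝ) = M at *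
  -- M = 0 forces k = 0 and both exponents are 0. Otherwise |T| = 2M ≤ 2Kk, and 1024 = 4² · (4 · 8 ·
  -- 2).
  rcases hM0.eq_or_lt with hM0 | hM0
  · have : k = 0 := by nlinarith
    rw [this, ← hM0]
    simp
  · rw [le_div_iff₀ (by push_cast; linarith)]
    have hsq := pow_le_pow_left₀ (by positivity) hmean 2
    refine le_trans ?_ hsq
    have : k * (margin q K ρ ^ 2 * K) * M ≤ k * (margin q K ρ ^ 2 * K) * (K * k) :=
      mul_le_mul_of_nonneg_left hM3' (by positivity)
    push_cast
    nlinarith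

end Estimate

end

/-! ### From pairs of matchings to the maximizers. -/

section Argmax

variable {m n K : ℕ}

/-- The matrix whose ones are at the positions in `P`. -/
def indMatrix (P : Finset (Fin m × Fin n)) : Matrix (Fin m) (Fin n) ℝ :=
  Matrix.of fun i j => if (i, j) ∈ P then 1 else 0

lemma sum_mul_indMatrix (P : Finset (Fin m × Fin n)) (f : Fin m → Fin n → ℝ) :
    ∑ i, ∑ j, f i j * indMatrix P i j = ∑ s ∈ P, f s.1 s.2 := by
  rw [← Fintype.sum_prod_type' fun i j => f i j * indMatrix P i j]
  simp [indMatrix]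

lemma coreMatrix_eq_indMatrix : coreMatrix m n K = indMatrix (corePairs m n K) := by
  ext i j
  simp [coreMatrix, indMatrix, mem_corePairs]

lemma IsMatching.indMatrix_mem {P : Finset (Fin m × Fin n)} (hP : IsMatching K P) :
    indMatrix P ∈ partialPerms m n K := by
  refine ⟨fun i j => ?_, fun i => ?_, fun j => ?_, ?_⟩
  · simp only [indMatrix, Matrix.of_apply]
    split_ifs <;> simp
  · simp only [indMatrix, Matrix.of_apply, Finset.sum_boole]
    refine Nat.cast_le_one.2 (Finset.card_le_one.2 fun a ha b hb => ?_)
    exact congr_arg Prod.snd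
      (hP.injOn_fst (Finset.mem_filter.1 ha).2 (Finset.mem_filter.1 hb).2 rfl)
  · simp only [indMatrix, Matrix.of_apply, Finset.sum_boole]
    refine Nat.cast_le_one.2 (Finset.card_le_one.2 fun a ha b hb => ?_)
    exact congr_arg Prod.fst
      (hP.injOn_snd (Finset.mem_filter.1 ha).2 (Finset.mem_filter.1 hb).2 rfl)
  · simpa [hP.card_eq] using sum_mul_indMatrix P fun _ _ => 1

lemma exists_isMatching {X : Matrix (Fin m) (Fin n) ℝ} (hX : X ∈ partialPerms m n K) :
    ∃ P, IsMatching K P ∧ X = indMatrix P := by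
  classical
  obtain ⟨h01, hr, hc, hs⟩ := hX
  have h0 : ∀ i j, 0 ≤ X i j := fun i j => by rcases h01 i j with h | h <;> rw [h]; norm_num
  let P : Finset (Fin m × Fin n) := Finset.univ.filter fun s => X s.1 s.2 = 1
  have hXP : X = indMatrix P := by
    ext i j
    rcases h01 i j with h | h <;> simp [indMatrix, P, h]
  refine ⟨P, ⟨?_, ?_, ?_⟩, hXP⟩
  · have := sum_mul_indMatrix P fun _ _ => 1
    simp only [← hXP, one_mul] at this
    rw [hs] at this
    simpa using this.symm
  · rintro ⟨i, j⟩ hs ⟨i', j'⟩ ht (rfl : i = i')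
    by_contra hne
    have hjj : j ≠ j' := fun e => hne (by rw [e])
    have h1 : X i j = 1 := by simpa [P] using hs
    have h2 : X i j' = 1 := by simpa [P] using ht
    have := Finset.sum_le_sum_of_subset_of_nonneg (Finset.subset_univ {j, j'})
      fun k _ _ => h0 i k
    rw [Finset.sum_pair hjj, h1, h2] at this
    linarith [hr i]
  · rintro ⟨i, j⟩ hs ⟨i', j'⟩ ht (rfl : j = j')
    by_contra hne
    have hii : i ≠ i' := fun e => hne (by rw [e])
    have h1 : X i j = 1 := by simpa [P] using hs
    have h2 : X i' j = 1 := by simpa [P] using ht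
    have := Finset.sum_le_sum_of_subset_of_nonneg (Finset.subset_univ {i, i'})
      fun k _ _ => h0 k j
    rw [Finset.sum_pair hii, h1, h2] at this
    linarith [hc j]

/-- The bilinear form whose quadratic form is `objective A B`. -/
def objectiveBilin (A : Matrix (Fin m) (Fin m) ℝ) (B : Matrix (Fin n) (Fin n) ℝ) :
    Matrix (Fin m) (Fin n) ℝ →ₗ[ℝ] Matrix (Fin m) (Fin n) ℝ →ₗ[ℝ] ℝ :=
  LinearMap.mk₂ ℝ (fun X Y => (A * X * B * Y.transpose).trace)
    (fun X X' Y => by simp [Matrix.mul_add, Matrix.add_mul])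
    (fun a X Y => by simp)
    (fun X Y Y' => by simp [Matrix.mul_add])
    (fun a X Y => by simp)

lemma objectiveBilin_indMatrix {A : Matrix (Fin m) (Fin m) ℝ} {B : Matrix (Fin n) (Fin n) ℝ}
    (hA : ∀ i j, A i j = A j i) (P Q : Finset (Fin m × Fin n)) :
    objectiveBilin A B (indMatrix P) (indMatrix Q) = overlap A B P Q := by
  have hPent : ∀ a b, (A * indMatrix P * B) a b = ∑ s ∈ P, A a s.1 * B s.2 b := by
    intro a b
    rw [← sum_mul_indMatrix P fun i j => A a i * B j b, Finset.sum_comm]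
    simp only [Matrix.mul_apply, Finset.sum_mul]
    exact Finset.sum_congr rfl fun j _ => Finset.sum_congr rfl fun i _ => by ring
  calc (A * indMatrix P * B * (indMatrix Q).transpose).trace
      = ∑ i, ∑ j, (A * indMatrix P * B) i j * indMatrix Q i j := by
        simp only [Matrix.trace, Matrix.diag_apply]
        refine Finset.sum_congr rfl fun i _ => ?_
        rw [Matrix.mul_apply]
        rfl
    _ = ∑ t ∈ Q, ∑ s ∈ P, A s.1 t.1 * B s.2 t.2 := by
        rw [sum_mul_indMatrix Q fun i j => (A * indMatrix P * B) i j]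
        refine Finset.sum_congr rfl fun t _ => ?_
        rw [hPent]
        exact Finset.sum_congr rfl fun s _ => by rw [hA]
    _ = overlap A B P Q := by
        rw [Finset.sum_comm, overlap, Finset.sum_product]

lemma argmaxOn_eq_singleton {α : Type*} {f : α → ℝ} {S : Set α} {z : α} (hz : z ∈ S)
    (h : ∀ x ∈ S, x ≠ z → f x < f z) : argmaxOn f S = {z} := by
  ext x
  constructor
  · rintro ⟨hx, hmax⟩
    by_contra hne
    exact (h x hx hne).not_ge (hmax z hz)
  · rintro rfl
    refine ⟨hz, fun y hy => ?_⟩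
    by_cases e : y = x
    · rw [e]
    · exact (h y hy e).le

lemma partialPerms_subset_relaxedPolytope : partialPerms m n K ⊆ relaxedPolytope m n K :=
  fun X hX => ⟨fun i j => by rcases hX.1 i j with h | h <;> rw [h]; norm_num, hX.2⟩

/-- If the overlap of the core with itself beats that of any other pair of matchings, then the core
matrix is the only maximizer, both over the partial permutation matrices and over the relaxation. -/
theorem argmaxOn_objective_eq {A : Matrix (Fin m) (Fin m) ℝ} {B : Matrix (Fin n) (Fin n) ℝ}
    (hA : ∀ i j, A i j = A j i) (hm : K ≤ m) (hn : K ≤ n)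
    (h : ∀ P Q : Finset (Fin m × Fin n), IsMatching K P → IsMatching K Q →
      (P, Q) ≠ (corePairs m n K, corePairs m n K) →
      overlap A B P Q < overlap A B (corePairs m n K) (corePairs m n K)) :
    argmaxOn (objective A B) (partialPerms m n K) = {coreMatrix m n K} ∧
      argmaxOn (objective A B) (relaxedPolytope m n K) = {coreMatrix m n K} := by
  have hz : coreMatrix m n K ∈ partialPerms m n K := by
    rw [coreMatrix_eq_indMatrix]
    exact (isMatching_corePairs hm hn).indMatrix_mem
  have hS : ∀ X ∈ partialPerms m n K, ∀ Y ∈ partialPerms m n K,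
      (X, Y) ≠ (coreMatrix m n K, coreMatrix m n K) →
      objectiveBilin A B X Y < objectiveBilin A B (coreMatrix m n K) (coreMatrix m n K) := by
    intro X hX Y hY hne
    obtain ⟨P, hP, rfl⟩ := exists_isMatching hX
    obtain ⟨Q, hQ, rfl⟩ := exists_isMatching hY
    rw [coreMatrix_eq_indMatrix, objectiveBilin_indMatrix hA, objectiveBilin_indMatrix hA]
    refine h P Q hP hQ fun e => hne ?_
    rw [Prod.mk.injEq] at e
    rw [coreMatrix_eq_indMatrix, e.1, e.2]
  have hlt : ∀ X ∈ relaxedPolytope m n K, X ≠ coreMatrix m n K →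
      objective A B X < objective A B (coreMatrix m n K) := fun X hX hne =>
    quadratic_lt_of_mem_convexHull (objectiveBilin A B) hz hS
      (relaxedPolytope_subset_convexHull hm hn hX) hne
  exact ⟨argmaxOn_eq_singleton hz fun X hX => hlt X (partialPerms_subset_relaxedPolytope hX),
    argmaxOn_eq_singleton (partialPerms_subset_relaxedPolytope hz) hlt⟩

end Argmax

/-! ### Union bound over pairs of matchings. -/

section UnionBound

lemma sum_pow_card_symmDiff {α : Type*} [Fintype α] [DecidableEq α] (C : Finset α) (y : ℝ) :
    ∑ P : Finset α, y ^ (symmDiff P C).card = (1 + y) ^ Fintype.card α := by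
  have hbij : Function.Involutive fun P : Finset α => symmDiff P C := fun P =>
    symmDiff_symmDiff_cancel_right C P
  rw [← Equiv.sum_comp hbij.toPerm]
  simp only [Function.Involutive.coe_toPerm, symmDiff_symmDiff_cancel_right]
  simpa [add_comm] using Fintype.sum_pow_mul_eq_add_pow α y 1

/-- The full sum is (1+y)^(2|α|) ≤ exp(2|α|y), the pair (C, C) contributes exactly 1, and exp x - 1
≤ 2x for 0 ≤ x ≤ 1. -/
lemma sum_pow_card_symmDiff_le {α : Type*} [Fintype α] [DecidableEq α] (C : Finset α) {y : ℝ}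
    (hy : 0 ≤ y) (hy1 : 2 * Fintype.card α * y ≤ 1) :
    ∑ R ∈ (Finset.univ : Finset (Finset α × Finset α)).erase (C, C),
      y ^ ((symmDiff R.1 C).card + (symmDiff R.2 C).card) ≤ 4 * Fintype.card α * y := by
  have htot : ∑ R : Finset α × Finset α, y ^ ((symmDiff R.1 C).card + (symmDiff R.2 C).card) =
      (1 + y) ^ (2 * Fintype.card α) := by
    rw [Fintype.sum_prod_type]
    simp only [pow_add, ← Finset.mul_sum, ← Finset.sum_mul, sum_pow_card_symmDiff]
    rw [two_mul, pow_add]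
  rw [← Finset.add_sum_erase _ _ (Finset.mem_univ (C, C))] at htot
  simp only [symmDiff_self, Finset.bot_eq_empty, Finset.card_empty, add_zero, pow_zero] at htot
  have h1 : (1 + y) ^ (2 * Fintype.card α) ≤ Real.exp (2 * Fintype.card α * y) := by
    calc (1 + y) ^ (2 * Fintype.card α) ≤ (Real.exp y) ^ (2 * Fintype.card α) :=
          pow_le_pow_left₀ (by positivity) (by linarith [Real.add_one_le_exp y]) _
      _ = _ := by rw [← Real.exp_nat_mul]; push_cast; rfl
  have h0 : 0 ≤ 2 * Fintype.card α * y := by positivity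
  have h2 := Real.abs_exp_sub_one_le (x := 2 * Fintype.card α * y) (by rwa [abs_of_nonneg h0])
  rw [abs_of_nonneg h0] at h2
  linarith [(abs_le.1 h2).2]

variable {Ω : Type*} [MeasurableSpace Ω] {μ : Measure Ω} [IsProbabilityMeasure μ] {m n K : ℕ}
  {p ρ : ℕ → ℕ → ℝ} {G : Ω → SimpleGraph (Fin m)} {H : Ω → SimpleGraph (Fin n)}

/-- Some pair of matchings other than the core has an overlap as large as that of the core. -/
def mismatchEvent (K : ℕ) (G : Ω → SimpleGraph (Fin m)) (H : Ω → SimpleGraph (Fin n)) : Set Ω :=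
  {ω | ∃ P Q : Finset (Fin m × Fin n), IsMatching K P ∧ IsMatching K Q ∧
    (P, Q) ≠ (corePairs m n K, corePairs m n K) ∧
    overlap (signMatrix (G ω)) (signMatrix (H ω)) (corePairs m n K) (corePairs m n K) ≤
      overlap (signMatrix (G ω)) (signMatrix (H ω)) P Q}

theorem measure_mismatchEvent_le (h : IsCorrelatedBernoulli μ m n K p ρ G H) {q : ℝ}
    (hq : 0 < q) (hp : ∀ i j, i < j → j < max m n → p i j ∈ Set.Icc q (1 - q))
    (hρ : ∀ i j, i < j → j < K → (1 - 2 * q) ^ 2 < ρ i j) (hK : 2 ≤ K)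
    (hε : 8 ≤ K * margin q K ρ) {N : ℕ} (hN : max m n = N) (hN2 : 2 ≤ N)
    (hlog : 8192 * Real.log N ≤ margin q K ρ ^ 2 * K) :
    μ.real (mismatchEvent K G H) ≤ 4 * ((N : ℝ) ^ 2)⁻¹ := by
  classical
  set C := corePairs m n K with hC
  have hCm : IsMatching K C := isMatching_corePairs h.core_le_left h.core_le_right
  -- N⁻⁴ outweighs the at most N² positions. Since |P Δ C| = 2|C \ P|, a pair at distance k is
  -- weighted by y^(2k) = N^(-8k), which is why 8192 = 8 · 1024 is needed.
  set y : ℝ := ((N : ℝ) ^ 4)⁻¹ with hy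
  have hNpos : (0 : ℝ) < N := by exact_mod_cast (by omega : 0 < N)
  have hy0 : 0 ≤ y := by positivity
  have hcard : ((Fintype.card (Fin m × Fin n) : ℕ) : ℝ) ≤ (N : ℝ) ^ 2 := by
    have h1 : m ≤ N := by omega
    have h2 : n ≤ N := by omega
    have : m * n ≤ N ^ 2 := by rw [sq]; exact Nat.mul_le_mul h1 h2
    simp only [Fintype.card_prod, Fintype.card_fin]
    exact_mod_cast this
  have hcardy : (Fintype.card (Fin m × Fin n) : ℝ) * y ≤ ((N : ℝ) ^ 2)⁻¹ := by
    calc _ ≤ (N : ℝ) ^ 2 * y := mul_le_mul_of_nonneg_right hcard hy0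
      _ = _ := by rw [hy]; field_simp
  have hterm : ∀ P Q : Finset (Fin m × Fin n), IsMatching K P → IsMatching K Q →
      μ.real {ω | overlap (signMatrix (G ω)) (signMatrix (H ω)) C C ≤
        overlap (signMatrix (G ω)) (signMatrix (H ω)) P Q} ≤
      y ^ ((symmDiff P C).card + (symmDiff Q C).card) := by
    intro P Q hP hQ
    refine (measure_overlap_le h hq hp hρ hK hP hQ hε).trans ?_
    have hsd : ∀ P : Finset (Fin m × Fin n), IsMatching K P →
        (symmDiff P C).card = 2 * (C \ P).card := by
      intro P hP
      rw [symmDiff_def, Finset.sup_eq_union, Finset.card_union_of_disjoint disjoint_sdiff_sdiff,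
        Finset.card_sdiff_comm (hP.card_eq.trans hCm.card_eq.symm), two_mul]
    rw [hsd P hP, hsd Q hQ, ← mul_add, ← hC]
    generalize (C \ P).card + (C \ Q).card = k
    have hyexp : y = Real.exp (-(4 * Real.log N)) := by
      rw [Real.exp_neg, hy, mul_comm, Real.exp_mul, Real.exp_log hNpos]
      norm_cast
    rw [hyexp, ← Real.exp_nat_mul, Real.exp_le_exp]
    have := mul_le_mul_of_nonneg_left hlog (Nat.cast_nonneg (α := ℝ) k)
    push_cast
    linarith
  calc μ.real (mismatchEvent K G H)
      ≤ μ.real (⋃ R ∈ ((Finset.univ : Finset (Finset (Fin m × Fin n) × Finset (Fin m × Fin n))).erase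
          (C, C)).filter (fun R => IsMatching K R.1 ∧ IsMatching K R.2),
          {ω | overlap (signMatrix (G ω)) (signMatrix (H ω)) C C ≤
            overlap (signMatrix (G ω)) (signMatrix (H ω)) R.1 R.2}) := by
        refine measureReal_mono ?_ (measure_ne_top _ _)
        rintro ω ⟨P, Q, hP, hQ, hne, hle⟩
        simp only [Set.mem_iUnion]
        exact ⟨(P, Q), Finset.mem_filter.2 ⟨Finset.mem_erase.2 ⟨hne, Finset.mem_univ _⟩, hP, hQ⟩, hle⟩
    _ ≤ ∑ R ∈ ((Finset.univ : Finset (Finset (Fin m × Fin n) × Finset (Fin m × Fin n))).erase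
          (C, C)).filter (fun R => IsMatching K R.1 ∧ IsMatching K R.2),
          y ^ ((symmDiff R.1 C).card + (symmDiff R.2 C).card) := by
        refine (measureReal_biUnion_finset_le _ _).trans (Finset.sum_le_sum fun R hR => ?_)
        obtain ⟨-, hP, hQ⟩ := Finset.mem_filter.1 hR
        exact hterm _ _ hP hQ
    -- Dropping the matching condition only adds nonnegative terms and makes the sum explicit.
    _ ≤ ∑ R ∈ (Finset.univ : Finset (Finset (Fin m × Fin n) × Finset (Fin m × Fin n))).erase (C, C),
          y ^ ((symmDiff R.1 C).card + (symmDiff R.2 C).card) :=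
        Finset.sum_le_sum_of_subset_of_nonneg (Finset.filter_subset _ _) fun _ _ _ => by positivity
    _ ≤ 4 * Fintype.card (Fin m × Fin n) * y := by
        refine sum_pow_card_symmDiff_le C hy0 ?_
        have : ((N : ℝ) ^ 2)⁻¹ ≤ 4⁻¹ := by
          refine inv_anti₀ (by norm_num) ?_
          have : (2 : ℝ) ≤ N := by exact_mod_cast hN2
          nlinarith
        linarith
    _ ≤ _ := by linarith

end UnionBound

/-! ### Borel–Cantelli and conclusion. -/

lemma ae_eventually_notMem_of_le {Ω : Type*} [MeasurableSpace Ω] {μ : Measure Ω}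
    [IsFiniteMeasure μ] {s : ℕ → Set Ω} {f : ℕ → ℝ} (hf : Summable f)
    (h : ∀ᶠ N in Filter.atTop, μ.real (s N) ≤ f N) :
    ∀ᵐ ω ∂μ, ∀ᶠ N in Filter.atTop, ω ∉ s N := by
  obtain ⟨N₀, hN₀⟩ := Filter.eventually_atTop.1 h
  have hsum : ∑' N, μ (s (N + N₀)) ≠ ⊤ := by
    refine ne_top_of_le_ne_top (b := ∑' N, ENNReal.ofReal (f (N + N₀))) ?_
      (ENNReal.tsum_le_tsum fun N => ?_)
    · exact ((summable_nat_add_iff N₀).2 hf).tsum_ofReal_ne_top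
    · rw [← ofReal_measureReal]
      exact ENNReal.ofReal_le_ofReal (hN₀ _ (Nat.le_add_left _ _))
  filter_upwards [ae_eventually_notMem hsum] with ω hω
  rw [← Filter.map_add_atTop_eq_nat N₀, Filter.eventually_map]
  exact hω

end SubgraphMatching

open SubgraphMatching

theorem theorem1 {Ω : Type*} [MeasurableSpace Ω] (μ : MeasureTheory.Measure Ω)
    [MeasureTheory.IsProbabilityMeasure μ]
    (m n K : ℕ → ℕ) (p ρ : ℕ → ℕ → ℕ → ℝ)
    (G : (N : ℕ) → Ω → SimpleGraph (Fin (m N))) (H : (N : ℕ) → Ω → SimpleGraph (Fin (n N)))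
    (hmax : ∀ N, 1 ≤ N → max (m N) (n N) = N)
    (hmodel : ∀ N, 1 ≤ N →
      SubgraphMatching.IsCorrelatedBernoulli μ (m N) (n N) (K N) (p N) (ρ N) (G N) (H N))
    (q : ℝ) (hq0 : 0 < q) (hq : q < 1 / 2)
    (hp : ∀ N, 1 ≤ N → ∀ i j, i < j → j < N → p N i j ∈ Set.Icc q (1 - q))
    (hρ : ∀ N, 1 ≤ N → ∀ i j, i < j → j < K N → (1 - 2 * q) ^ 2 < ρ N i j)
    (hε : Filter.Tendsto
      (fun N : ℕ => SubgraphMatching.margin q (K N) (ρ N) ^ 2 * (K N : ℝ) / Real.log (N : ℝ))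
      Filter.atTop Filter.atTop) :
    ∀ᵐ ω ∂μ, ∀ᶠ N in Filter.atTop,
      SubgraphMatching.argmaxOn
          (SubgraphMatching.objective (SubgraphMatching.signMatrix (G N ω))
            (SubgraphMatching.signMatrix (H N ω)))
          (SubgraphMatching.partialPerms (m N) (n N) (K N)) =
        {SubgraphMatching.coreMatrix (m N) (n N) (K N)} ∧
      SubgraphMatching.argmaxOn
          (SubgraphMatching.objective (SubgraphMatching.signMatrix (G N ω))
            (SubgraphMatching.signMatrix (H N ω)))
          (SubgraphMatching.relaxedPolytope (m N) (n N) (K N)) =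
        {SubgraphMatching.coreMatrix (m N) (n N) (K N)} := by
  have hprob : ∀ᶠ N in Filter.atTop,
      μ.real (mismatchEvent (K N) (G N) (H N)) ≤ 4 * ((N : ℝ) ^ 2)⁻¹ := by
    filter_upwards [hε.eventually_ge_atTop 8192, Filter.eventually_ge_atTop 3] with N hN hN3
    -- N ≥ 3 > e, so the bound on the quotient gives ε²K ≥ 8192. In particular ε ≠ 0, which rules
    -- out K ≤ 1.
    have hlog1 : 1 ≤ Real.log (N : ℝ) := by
      rw [Real.le_log_iff_exp_le (by exact_mod_cast (by omega : 0 < N))]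
      have : (3 : ℝ) ≤ N := by exact_mod_cast hN3
      linarith [Real.exp_one_lt_d9]
    rw [le_div_iff₀ (by linarith)] at hN
    have hNone : 1 ≤ N := by omega
    have hK : 2 ≤ K N := by
      by_contra hK
      rw [margin_eq_zero (by omega)] at hN
      norm_num at hN
      linarith
    have hmargin0 := margin_nonneg (hρ N hNone)
    have hmargin1 : margin q (K N) (ρ N) ≤ 1 := by
      have h1 := margin_le (hρ N hNone) zero_lt_one hK
      have h2 := ((hmodel N hNone).ρ_mem 0 1 zero_lt_one hK).2
      nlinarith [sq_nonneg (1 - 2 * q)]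
    refine measure_mismatchEvent_le (hmodel N hNone) hq0 ?_ (hρ N hNone) hK ?_ (hmax N hNone)
      (by omega) hN
    · rw [hmax N hNone]
      exact hp N hNone
    -- As 0 ≤ ε ≤ 1, Kε ≥ ε²K ≥ 8192, far more than the required 8.
    · have : margin q (K N) (ρ N) ^ 2 * (K N : ℝ) ≤ K N * margin q (K N) (ρ N) := by
        rw [sq, mul_comm]
        exact mul_le_mul_of_nonneg_left (mul_le_of_le_one_left hmargin0 hmargin1)
          (Nat.cast_nonneg _)
      linarith
  have hsummable : Summable fun N : ℕ => 4 * ((N : ℝ) ^ 2)⁻¹ :=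
    (Real.summable_nat_pow_inv.2 one_lt_two).mul_left 4
  filter_upwards [ae_eventually_notMem_of_le hsummable hprob] with ω hω
  filter_upwards [hω, Filter.eventually_ge_atTop 1] with N hN hN1
  refine argmaxOn_objective_eq (signMatrix_comm _) (hmodel N hN1).core_le_left
    (hmodel N hN1).core_le_right fun P Q hP hQ hne => ?_
  by_contra hlt
  exact hN ⟨P, Q, hP, hQ, hne, not_lt.1 hlt⟩
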